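/- Let $d\ge 2$, $\alpha>d$, $J>0$, $m>0$. Let $|\cdot|$ be the $\ell^1$ norm on $\mathbb Z^d$ (with its nearest-neighbour connectivity), $J_{xy}=J/|x-y|^{\alpha}$ for $x\ne y$, $J_{xx}=0$, and $F_A=\sum_{x\in A,\,y\notin A}J_{xy}$. For finite $A\subset\mathbb Z^d$ let $V(A)$ be the complement of the unbounded connected component of $A^c$. Model. Let $q\ge 2$, $\mathbb Z_q=\{1,\dots,q\}$ (so $q$ is the zero element), and $\psi:\mathbb Z_q\to[0,1]$ with $\psi(0)=0$ and $\min_{n\ne0}\psi(n)=m$. For finite $\Lambda\subset\mathbb Z^d$, let $\Omega^q_\Lambda$ be the set of $\sigma:\mathbb Z^d\to\mathbb Z_q$ with $\sigma_x=q$ for all $x\notin\Lambda$, and $$H^q_\Lambda(\sigma)=\tfrac12\sum_{x,y\in\Lambda}J_{xy}\,\psi(\sigma_x-\sigma_y)+\sum_{x\in\Lambda,\;y\notin\Lambda}J_{xy}\,\psi(\sigma_x-q).$$ Contours. Let $a=\frac{3(d+1)}{\min(\alpha-d,1)}$ and $M>0$. An $(M,a)$-partition of a finite set $A$ is a partition of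 $A$ into nonempty parts such that any two distinct parts $B,C$ satisfy $\mathrm{dist}(B,C)>M\min\{|V(B)|,|V(C)|\}^{a/(d+1)}$; there is a finest one. The boundary $\partial\sigma$ is the set of $x$ such that $\sigma$ is not constant on the closed unit $\ell^1$ ball around $x$. The contours of $\sigma\in\Omega^q_\Lambda$ are the pairs $\gamma=(\bar\gamma,\sigma|_{\bar\gamma})$ with $\bar\gamma$ a part of the finest $(M,a)$-partition of $\partial\sigma$; write $\mathrm{sp}(\gamma)=\bar\gamma$, $|\gamma|=|\bar\gamma|$, $V(\gamma)=V(\bar\gamma)$, $I(\gamma)=V(\gamma)\setminus\bar\gamma$. A contour $\gamma$ of $\sigma$ is external if $\mathrm{sp}(\gamma)\cap V(\gamma')=\emptyset$ for every other contour $\gamma'$ of $\sigma$. A connected component $C$ of $I(\gamma)$ has label $n\in\mathbb Z_q$ if $\sigma=n$ at all sites of $V(C)^c$ adjacent to $V(C)$; $I_n(\gamma)$ is the union of the components with label $n$, and $I'(\gamma)=\bigcup_{n\ne q}I_n(\gamma)$. Define $\tau=\tau_\gamma(\sigma)$ by $\tau_x=q$ for $x\in\mathrm{sp}(\gamma)$,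 $\tau_x=\sigma_x-n$ for $x\in I_n(\gamma)$, and $\tau_x=\sigma_x$ otherwise. Claim. There are constants $c_2>0$ and $M_0>0$, depending only on $J,m,\alpha,d$, such that for every $M\ge M_0$, all $q$, $\psi$ as above, every finite $\Lambda\subset\mathbb Z^d$, every $\sigma\in\Omega^q_\Lambda$ and every external contour $\gamma$ of $\sigma$: 1. if $\mathbb Z^d\setminus\Lambda$ is connected, then $\tau_\gamma(\sigma)\in\Omega^q_\Lambda$; 2. whenever $\tau=\tau_\gamma(\sigma)\in\Omega^q_\Lambda$ (in particular, whenever $\mathbb Z^d\setminus\Lambda$ is connected), $$H^q_\Lambda(\sigma)-H^q_\Lambda(\tau)\ \ge\ c_2\Big(|\gamma|+F_{\mathrm{sp}(\gamma)}+\sum_{n=1}^{q-1}F_{I_n(\gamma)}+F_{I'(\gamma)}\Big).$$ -/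

import Mathlib

namespace LongRange

/-! ### The lattice `ℤ^d` -/

/-- The `ℓ¹` distance on `ℤ^d`. -/
def l1dist {d : ℕ} (x y : Fin d → ℤ) : ℕ := ∑ i, (x i - y i).natAbs

theorem l1dist_comm {d : ℕ} (x y : Fin d → ℤ) : l1dist x y = l1dist y x := by
  unfold l1dist
  refine Finset.sum_congr rfl fun i _ => ?_
  rw [← Int.natAbs_neg, neg_sub]

/-- The nearest neighbour graph on `ℤ^d`. -/
def lattice (d : ℕ) : SimpleGraph (Fin d → ℤ) where
  Adj x y := l1dist x y = 1
  symm := ⟨fun x y h => by rw [l1dist_comm]; exact h⟩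
  loopless := ⟨fun x h => by simp [l1dist] at h⟩

/-- The connected component of the site `x` in the set `S`, for nearest neighbour paths
staying in `S` (it is empty when `x ∉ S`). -/
def component {d : ℕ} (S : Set (Fin d → ℤ)) (x : Fin d → ℤ) : Set (Fin d → ℤ) :=
  {y | ∃ (hx : x ∈ S) (hy : y ∈ S), ((lattice d).induce S).Reachable ⟨x, hx⟩ ⟨y, hy⟩}

/-- The volume `V(S)`: the complement of the unbounded connected component of `Sᶜ`, that is,
`S` together with all the bounded connected components of `Sᶜ`. -/
def vol {d : ℕ} (S : Set (Fin d → ℤ)) : Set (Fin d → ℤ) :=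
  {x | (component Sᶜ x).Finite}

/-- The interior `I(S) = V(S) \ S`. -/
def inter {d : ℕ} (S : Set (Fin d → ℤ)) : Set (Fin d → ℤ) := vol S \ S

/-- The exterior boundary: the sites outside `S` with a nearest neighbour in `S`. -/
def extBoundary {d : ℕ} (S : Set (Fin d → ℤ)) : Set (Fin d → ℤ) :=
  {y | y ∉ S ∧ ∃ x ∈ S, l1dist x y = 1}

/-! ### The coupling and the energy -/

/-- The coupling `J_{xy} = J / |x - y|^α` for `x ≠ y`, and `J_{xx} = 0`. -/
noncomputable def coupling {d : ℕ} (J α : ℝ) (x y : Fin d → ℤ) : ℝ :=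
  if x = y then 0 else J / (l1dist x y : ℝ) ^ α

/-- `F_A`, the total coupling between `A` and its complement. -/
noncomputable def surfaceEnergy {d : ℕ} (J α : ℝ) (A : Set (Fin d → ℤ)) : ℝ :=
  ∑' p : ↥A × ↥Aᶜ, coupling J α p.1.1 p.2.1

/-- The energy in `Λ` of `σ` with boundary condition `η` and pair interaction `J_{xy} f(σ_x - σ_y)`.
The sum over unordered pairs `{x, y} ⊆ Λ` is written as half of the sum over ordered pairs. -/
noncomputable def energy {d q : ℕ} (J α : ℝ) (f : ZMod q → ℝ) (Λ : Finset (Fin d → ℤ))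
    (η σ : (Fin d → ℤ) → ZMod q) : ℝ :=
  (1 / 2) * ∑ x ∈ Λ, ∑ y ∈ Λ, coupling J α x y * f (σ x - σ y) +
    ∑ x ∈ Λ, ∑' y : {y : Fin d → ℤ // y ∉ Λ}, coupling J α x y * f (σ x - η y)

/-- The set `Ω_Λ^r` of the configurations equal to `r` outside `Λ`. -/
def configs {d q : ℕ} (Λ : Finset (Fin d → ℤ)) (r : ZMod q) : Set ((Fin d → ℤ) → ZMod q) :=
  {σ | ∀ x, x ∉ Λ → σ x = r}

/-! ### Contours -/

/-- The boundary `∂σ`: the set of the incorrect sites of `σ`, those `x` for which `σ` is not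
constant on the unit `ℓ¹` ball centred at `x`. -/
def boundary {d q : ℕ} (σ : (Fin d → ℤ) → ZMod q) : Set (Fin d → ℤ) :=
  {x | ¬ ∃ r : ZMod q, ∀ y, l1dist x y ≤ 1 → σ y = r}

/-- `P` is an `(M, a)`-partition: distinct parts `B`, `C` satisfy
`dist(B, C) > M min(|V(B)|, |V(C)|)^(a/(d+1))`. -/
def IsMaPartition {d : ℕ} (M a : ℝ) {A : Finset (Fin d → ℤ)} (P : Finpartition A) : Prop :=
  ∀ B ∈ P.parts, ∀ C ∈ P.parts, B ≠ C → ∀ x ∈ B, ∀ y ∈ C,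
    M * (min (vol (B : Set (Fin d → ℤ))).ncard (vol (C : Set (Fin d → ℤ))).ncard : ℝ)
        ^ (a / ((d : ℝ) + 1)) < (l1dist x y : ℝ)

/-- A contour: a finite support together with the spins on it. -/
structure Contour (d q : ℕ) where
  sp : Finset (Fin d → ℤ)
  spin : sp → ZMod q

/-- The family `Γ(σ)` of the contours of `σ`: their supports are the parts of the finest
`(M, a)`-partition of `∂σ` (the order on partitions is refinement). -/
def contours {d q : ℕ} (M a : ℝ) (σ : (Fin d → ℤ) → ZMod q) : Set (Contour d q) :=
  {γ | ∃ (A : Finset (Fin d → ℤ)) (P : Finpartition A),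
    (A : Set (Fin d → ℤ)) = boundary σ ∧
    IsLeast {Q : Finpartition A | IsMaPartition M a Q} P ∧
    γ.sp ∈ P.parts ∧ ∀ x : γ.sp, γ.spin x = σ x}

namespace Contour

variable {d q : ℕ}

/-- The volume `V(γ)`. -/
def volume (γ : Contour d q) : Set (Fin d → ℤ) := vol (γ.sp : Set (Fin d → ℤ))

/-- The interior `I(γ)`. -/
def interior (γ : Contour d q) : Set (Fin d → ℤ) := inter (γ.sp : Set (Fin d → ℤ))

/-- The set `C` has label `n`: the spin of the contour is `n` at all sites of the (nonempty)
exterior boundary of `V(C)`. It is used for the connected components `C` of `I(γ)`. -/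
def HasLabel (γ : Contour d q) (C : Set (Fin d → ℤ)) (n : ZMod q) : Prop :=
  (extBoundary (vol C)).Nonempty ∧
    ∀ y ∈ extBoundary (vol C), ∃ h : y ∈ γ.sp, γ.spin ⟨y, h⟩ = n

/-- `I_n(γ)`: the union of the connected components of `I(γ)` with label `n`. -/
def interiorLabel (γ : Contour d q) (n : ZMod q) : Set (Fin d → ℤ) :=
  {x | x ∈ γ.interior ∧ γ.HasLabel (component γ.interior x) n}

/-- `I'(γ)`: the union of the `I_n(γ)` with `n ≠ q` (in `ℤ_q`, `q` is `0`). -/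
def interior' (γ : Contour d q) : Set (Fin d → ℤ) :=
  {x | ∃ n : ZMod q, n ≠ 0 ∧ x ∈ γ.interiorLabel n}

theorem interiorLabel_unique (γ : Contour d q) {x : Fin d → ℤ} {n n' : ZMod q}
    (h : x ∈ γ.interiorLabel n) (h' : x ∈ γ.interiorLabel n') : n = n' := by
  obtain ⟨y, hy⟩ := h.2.1
  obtain ⟨h1, h2⟩ := h.2.2 y hy
  obtain ⟨h3, h4⟩ := h'.2.2 y hy
  rw [← h2, ← h4]

open Classical in
/-- The map `τ_γ` erasing `γ`: the spin becomes `q` (that is, `0`) on `sp(γ)`, it is translated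
by `-n` on `I_n(γ)`, and it is unchanged elsewhere. -/
noncomputable def erase (γ : Contour d q) (σ : (Fin d → ℤ) → ZMod q) : (Fin d → ℤ) → ZMod q :=
  fun x => if x ∈ γ.sp then 0
    else if h : ∃ n : ZMod q, x ∈ γ.interiorLabel n then σ x - h.choose
    else σ x

theorem erase_of_mem_interiorLabel (γ : Contour d q) (σ : (Fin d → ℤ) → ZMod q)
    {x : Fin d → ℤ} {n : ZMod q} (h : x ∈ γ.interiorLabel n) : γ.erase σ x = σ x - n := by
  have hx : x ∉ γ.sp := fun hs => h.1.2 (by exact_mod_cast hs)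
  have hex : ∃ n : ZMod q, x ∈ γ.interiorLabel n := ⟨n, h⟩
  simp only [erase, hx, if_false, dif_pos hex]
  rw [γ.interiorLabel_unique hex.choose_spec h]

end Contour

/-- The external contours of a family `Γ`: those whose support does not meet the volume of
any other contour of the family. -/
def externalContours {d q : ℕ} (Γ : Set (Contour d q)) : Set (Contour d q) :=
  {γ | γ ∈ Γ ∧ ∀ γ' ∈ Γ, γ' ≠ γ → Disjoint (γ.sp : Set (Fin d → ℤ)) γ'.volume}

/-! ### The definitions are meaningful

Volumes of finite sets are finite, the finest `(M, a)`-partition exists, the boundary of a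
configuration in `Ω_Λ^r` is finite, and the series above converge. -/

theorem vol_finite {d : ℕ} {S : Set (Fin d → ℤ)} (hS : S.Finite) : (vol S).Finite := by
  obtain ⟨N, hN⟩ : ∃ N : ℤ, ∀ s ∈ S, ∀ i, |s i| ≤ N := by
    refine ⟨∑ s ∈ hS.toFinset, ∑ i, |s i|, fun s hs i => ?_⟩
    calc |s i| ≤ ∑ i, |s i| :=
          Finset.single_le_sum (f := fun i => |s i|) (fun _ _ => abs_nonneg _) (Finset.mem_univ i)
      _ ≤ _ := Finset.single_le_sum (f := fun s : Fin d → ℤ => ∑ i, |s i|)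
          (fun _ _ => Finset.sum_nonneg fun _ _ => abs_nonneg _) (hS.mem_toFinset.2 hs)
  refine (Set.finite_Icc (fun _ : Fin d => -N) (fun _ => N)).subset fun x hx => ?_
  suffices h : ∀ i, |x i| ≤ N from ⟨fun i => (abs_le.1 (h i)).1, fun i => (abs_le.1 (h i)).2⟩
  by_contra! hcon
  obtain ⟨i, hi⟩ := hcon
  obtain ⟨e, he, hpos⟩ : ∃ e : ℤ, e.natAbs = 1 ∧ ∀ k : ℕ, N < |x i + k * e| := by
    rcases le_total 0 (x i) with h | h
    · refine ⟨1, rfl, fun k => ?_⟩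
      rw [abs_of_nonneg h] at hi
      rw [abs_of_nonneg (by positivity)]
      omega
    · refine ⟨-1, rfl, fun k => ?_⟩
      rw [abs_of_nonpos h] at hi
      rw [abs_of_nonpos (by omega)]
      omega
  let r : ℕ → (Fin d → ℤ) := fun k => Function.update x i (x i + k * e)
  have hr : ∀ k, r k ∈ Sᶜ := fun k hk => by
    have := hN _ hk i
    simp only [r, Function.update_self] at this
    exact absurd (hpos k) (not_lt.2 this)
  have h0 : r 0 = x := by simp [r]
  have hadj : ∀ k, l1dist (r k) (r (k + 1)) = 1 := fun k => by
    unfold l1dist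
    rw [Finset.sum_eq_single i]
    · simp only [r, Function.update_self]
      rw [show x i + (k : ℤ) * e - (x i + ((k + 1 : ℕ) : ℤ) * e) = -e by push_cast; ring,
        Int.natAbs_neg, he]
    · intro j _ hj
      simp [r, Function.update_of_ne hj]
    · simp
  have hreach : ∀ k, ((lattice d).induce Sᶜ).Reachable ⟨r 0, hr 0⟩ ⟨r k, hr k⟩ := fun k => by
    induction k with
    | zero => exact SimpleGraph.Reachable.refl _
    | succ k ih =>
      refine ih.trans (SimpleGraph.Adj.reachable ?_)
      exact hadj k
  have hinj : Function.Injective r := fun k l hkl => by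
    have := congrFun hkl i
    simp only [r, Function.update_self, add_right_inj] at this
    have he0 : e ≠ 0 := fun h => by simp [h] at he
    exact_mod_cast mul_right_cancel₀ he0 this
  refine Set.infinite_of_injective_forall_mem hinj (s := component Sᶜ x) (fun k => ?_) hx
  have := hreach k
  refine ⟨h0 ▸ hr 0, hr k, ?_⟩
  simpa only [h0] using this

theorem vol_mono {d : ℕ} {S T : Set (Fin d → ℤ)} (h : S ⊆ T) : vol S ⊆ vol T := by
  intro x hx
  refine Set.Finite.subset hx ?_
  rintro y ⟨h1, h2, h3⟩
  refine ⟨fun hs => h1 (h hs), fun hs => h2 (h hs), ?_⟩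
  exact h3.map (SimpleGraph.induceHomOfLE (lattice d) (Set.compl_subset_compl.2 h)).toHom

theorem exists_finest {d : ℕ} {M a : ℝ} (hM : 0 ≤ M) (ha : 0 ≤ a) (A : Finset (Fin d → ℤ)) :
    ∃ P : Finpartition A, IsLeast {Q : Finpartition A | IsMaPartition M a Q} P := by
  classical
  have hsub : ∀ B C : Finset (Fin d → ℤ), B ⊆ C →
      (vol (B : Set (Fin d → ℤ))).ncard ≤ (vol (C : Set (Fin d → ℤ))).ncard := fun B C h =>
    Set.ncard_le_ncard (vol_mono (by exact_mod_cast h)) (vol_finite C.finite_toSet)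
  have htop : IsMaPartition M a (⊤ : Finpartition A) := by
    intro B hB C hC hBC
    have := Finpartition.parts_top_subset A
    have h1 := Finset.mem_singleton.1 (this hB)
    have h2 := Finset.mem_singleton.1 (this hC)
    exact absurd (h1.trans h2.symm) hBC
  have hinf : ∀ P Q : Finpartition A, IsMaPartition M a P → IsMaPartition M a Q →
      IsMaPartition M a (P ⊓ Q) := by
    have key : ∀ (P : Finpartition A), IsMaPartition M a P → ∀ B C B' C' : Finset (Fin d → ℤ),
        B ∈ P.parts → C ∈ P.parts → B ≠ C → B' ⊆ B → C' ⊆ C → ∀ x ∈ B', ∀ y ∈ C',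
        M * (min (vol (B' : Set (Fin d → ℤ))).ncard (vol (C' : Set (Fin d → ℤ))).ncard : ℝ)
        ^ (a / ((d : ℝ) + 1)) < (l1dist x y : ℝ) := by
      intro P hP B C B' C' hB hC hne h1 h2 x hx y hy
      refine lt_of_le_of_lt ?_ (hP B hB C hC hne x (h1 hx) y (h2 hy))
      have e1 : ((vol (B' : Set (Fin d → ℤ))).ncard : ℝ) ≤ (vol (B : Set (Fin d → ℤ))).ncard := by
        exact_mod_cast hsub _ _ h1
      have e2 : ((vol (C' : Set (Fin d → ℤ))).ncard : ℝ) ≤ (vol (C : Set (Fin d → ℤ))).ncard := by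
        exact_mod_cast hsub _ _ h2
      gcongr
    intro P Q hP hQ B hB C hC hne
    rw [Finpartition.parts_inf] at hB hC
    obtain ⟨⟨B1, B2⟩, hB1, rfl⟩ := Finset.mem_image.1 (Finset.mem_of_mem_erase hB)
    obtain ⟨⟨C1, C2⟩, hC1, rfl⟩ := Finset.mem_image.1 (Finset.mem_of_mem_erase hC)
    rw [Finset.mem_product] at hB1 hC1
    by_cases h : B1 = C1
    · have h' : B2 ≠ C2 := fun h' => hne (by simp only [h, h'])
      exact key Q hQ B2 C2 _ _ hB1.2 hC1.2 h' Finset.inter_subset_right Finset.inter_subset_right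
    · exact key P hP B1 C1 _ _ hB1.1 hC1.1 h Finset.inter_subset_left Finset.inter_subset_left
  let S : Finset (Finpartition A) := Finset.univ.filter fun Q => IsMaPartition M a Q
  refine ⟨S.inf id, ?_, ?_⟩
  · refine Finset.inf_induction (p := fun Q => IsMaPartition M a Q) htop
      (fun P hP Q hQ => hinf P Q hP hQ) fun Q hQ => ?_
    exact (Finset.mem_filter.1 hQ).2
  · intro Q hQ
    exact Finset.inf_le (f := id) (Finset.mem_filter.2 ⟨Finset.mem_univ _, hQ⟩)

theorem boundary_finite {d q : ℕ} {Λ : Finset (Fin d → ℤ)} {r : ZMod q}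
    {σ : (Fin d → ℤ) → ZMod q} (hσ : σ ∈ configs Λ r) : (boundary σ).Finite := by
  have hfin : (⋃ y ∈ Λ, {x | l1dist x y ≤ 1}).Finite := by
    refine Set.Finite.biUnion Λ.finite_toSet fun y _ => ?_
    refine (Set.finite_Icc (fun i => y i - 1) (fun i => y i + 1)).subset fun x hx => ?_
    have h : ∀ i, (x i - y i).natAbs ≤ 1 := fun i =>
      (Finset.single_le_sum (f := fun i => (x i - y i).natAbs) (fun _ _ => Nat.zero_le _)
        (Finset.mem_univ i)).trans hx
    exact ⟨fun i => by have := h i; simp only; omega, fun i => by have := h i; simp only; omega⟩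
  refine hfin.subset fun x hx => ?_
  by_contra hcon
  refine hx ⟨r, fun y hy => hσ y fun hyΛ => hcon ?_⟩
  exact Set.mem_biUnion hyΛ hy

theorem summable_coupling {d : ℕ} {J α : ℝ} (hα : (d : ℝ) < α) (x : Fin d → ℤ) :
    Summable fun y => coupling J α x y := by
  let b := Pi.basisFun ℝ (Fin d)
  let L := Submodule.span ℤ (Set.range b)
  have hrank : Module.finrank ℤ L = d := by
    rw [Module.finrank_eq_card_basis (b.restrictScalars ℤ)]
    simp
  have h := ZLattice.summable_norm_rpow L (-α) (by rw [hrank]; linarith)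
  let g : (Fin d → ℤ) → L := fun y => ⟨fun i => ((x i - y i : ℤ) : ℝ), by
    rw [b.mem_span_iff_repr_mem ℤ]
    intro i
    exact ⟨x i - y i, by simp [b]⟩⟩
  have hg : Function.Injective g := fun y z hyz => by
    funext i
    have := congrFun (congrArg Subtype.val hyz) i
    simp only [g, Int.cast_inj] at this
    omega
  have h2 := (h.comp_injective hg).mul_left |J|
  refine Summable.of_norm_bounded h2 fun y => ?_
  by_cases hxy : x = y
  · simp only [coupling, hxy, if_true, norm_zero]
    exact mul_nonneg (abs_nonneg _) (Real.rpow_nonneg (norm_nonneg _) _)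
  · simp only [coupling, hxy, if_false, Function.comp]
    have hpos : 0 < ‖g y‖ := by
      rw [norm_pos_iff]
      intro h0
      refine hxy (funext fun i => ?_)
      have := congrFun (congrArg Subtype.val h0) i
      simp only [g] at this
      have : ((x i - y i : ℤ) : ℝ) = 0 := this
      have : x i - y i = 0 := by exact_mod_cast this
      omega
    have hle : ‖g y‖ ≤ (l1dist x y : ℝ) := by
      refine (pi_norm_le_iff_of_nonneg (by positivity)).2 fun i => ?_
      have : (x i - y i).natAbs ≤ l1dist x y :=
        Finset.single_le_sum (f := fun i => (x i - y i).natAbs) (fun _ _ => Nat.zero_le _)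
        (Finset.mem_univ i)
      change |((x i - y i : ℤ) : ℝ)| ≤ _
      rw [← Int.cast_abs, Int.abs_eq_natAbs]
      exact_mod_cast this
    have hα0 : 0 ≤ α := (Nat.cast_nonneg d).trans hα.le
    rw [norm_div, Real.norm_eq_abs, Real.norm_of_nonneg (by positivity), Real.rpow_neg hpos.le,
      div_eq_mul_inv]
    gcongr

theorem summable_surfaceEnergy {d : ℕ} {J α : ℝ} (hα : (d : ℝ) < α) {A : Set (Fin d → ℤ)}
    (hA : A.Finite) :
    Summable fun p : ↥A × ↥Aᶜ =>
      coupling J α p.1.1 p.2.1 := by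
  have := hA.fintype
  rw [← summable_norm_iff]
  refine (summable_prod_of_nonneg fun _ => norm_nonneg _).2
    ⟨fun x => ?_, Summable.of_finite⟩
  exact ((summable_coupling hα x.1).comp_injective Subtype.val_injective).norm

theorem summable_energy {d q : ℕ} [NeZero q] {J α : ℝ} (hα : (d : ℝ) < α) (f : ZMod q → ℝ)
    (Λ : Finset (Fin d → ℤ)) (η : (Fin d → ℤ) → ZMod q) (x : Fin d → ℤ) (s : ZMod q) :
    Summable fun y : {y : Fin d → ℤ // y ∉ Λ} => coupling J α x y * f (s - η y) := by
  have h := ((summable_coupling (J := J) hα x).comp_injective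
    (Subtype.val_injective (p := fun y => y ∉ Λ))).norm.mul_right (∑ n, |f n|)
  refine Summable.of_norm_bounded h fun y => ?_
  rw [norm_mul]
  refine mul_le_mul_of_nonneg_left ?_ (norm_nonneg _)
  exact Finset.single_le_sum (f := fun n => |f n|) (fun _ _ => abs_nonneg _) (Finset.mem_univ _)

/-- The normalization of the energy: replacing the interaction `-φ` by `ψ`, with
`K ψ = φ(0) - φ` and the coupling constant `J` by `J K`, changes the energy by a constant. -/
theorem energy_normalized {d q : ℕ} [NeZero q] {J K α : ℝ} (hα : (d : ℝ) < α)
    (φ ψ : ZMod q → ℝ) (h : ∀ n, K * ψ n = φ 0 - φ n)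
    (Λ : Finset (Fin d → ℤ)) (η σ : (Fin d → ℤ) → ZMod q) :
    energy J α (fun n => -φ n) Λ η σ = energy (J * K) α ψ Λ η σ +
      energy J α (fun _ => -φ 0) Λ η σ := by
  have hc : ∀ (x y : Fin d → ℤ) (n : ZMod q), coupling J α x y * (-φ n) =
      coupling (J * K) α x y * ψ n + coupling J α x y * (-φ 0) := by
    intro x y n
    have h1 : -φ n = K * ψ n + -φ 0 := by rw [h]; ring
    rw [h1]
    unfold coupling
    split_ifs <;> ring
  have ht : ∀ x ∈ Λ, (∑' y : {y : Fin d → ℤ // y ∉ Λ}, coupling J α x y * (-φ (σ x - η y))) =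
      (∑' y : {y : Fin d → ℤ // y ∉ Λ}, coupling (J * K) α x y * ψ (σ x - η y)) +
      ∑' y : {y : Fin d → ℤ // y ∉ Λ}, coupling J α x y * (-φ 0) := by
    intro x _
    rw [← Summable.tsum_add (summable_energy hα ψ Λ η x (σ x))
      (summable_energy hα (fun _ => -φ 0) Λ η x (σ x))]
    exact tsum_congr fun y => hc _ _ _
  have hs : (∑ x ∈ Λ, ∑ y ∈ Λ, coupling J α x y * (-φ (σ x - σ y))) =
      (∑ x ∈ Λ, ∑ y ∈ Λ, coupling (J * K) α x y * ψ (σ x - σ y)) +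
      ∑ x ∈ Λ, ∑ y ∈ Λ, coupling J α x y * (-φ 0) := by
    simp only [← Finset.sum_add_distrib]
    exact Finset.sum_congr rfl fun x _ => Finset.sum_congr rfl fun y _ => hc _ _ _
  unfold energy
  rw [Finset.sum_congr rfl ht, Finset.sum_add_distrib, hs]
  ring

end LongRange

/-!
The argument rests on a phase function `h` for each contour `γ` (`IsPhase`): its gradient is the
gradient of `σ` on the edges that touch `sp(γ)` and zero on all other edges, and it vanishes outside
`V(γ)`. It exists because distinct parts of the `(M, a)`-partition are more than `2` apart: on a unit
square that meets `sp(γ)` the prescribed gradient is that of `σ`, so it is closed, and closed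
1-cochains on `ℤ^d` are exact (`exists_primitive_of_closed`). Comparing gradients shows that `σ` is
the sum of the phase functions of its contours (`eq_sum_phase`). Hence `σ = h` outside the volumes of
the other contours, in particular on `sp(γ)` when `γ` is external; the labels of the components of
`I(γ)` are the values of `h` there; and erasing `γ` is the subtraction `τ = σ - h` at every site
(`Contour.erase_eq_sub`). If `Λᶜ` is connected, `h` has zero gradient on it and vanishes far away, so
`τ` still vanishes outside `Λ`.

For the energy, only the pairs with `h x ≠ h y` change. Let `T` be the total coupling of these pairs.
If neither site lies in the volume of another contour, then `τ` vanishes at both and the pair gains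
at least `m J_{xy}`; otherwise it loses at most `J_{xy}`. The loss is a small fraction of `T`:
* A contour with `|V| = n ≤ |V(γ)|` has distance more than `4 L n³` from `sp(γ)`, so `h` is constant
  on large balls around its sites, and each of them can be spread over `L n³` sites with the same `h`
  and a comparable coupling. Contours of the same size are far apart, so at most `n` sites are spread
  over the same place, and the contribution is of order `T / (L n²)`, which is summable in `n`
  (`tsum_cut_card_le`).
* A contour with `|V| > |V(γ)|` is so far from `V(γ)` that the polynomial decay of the coupling beats
  the factor `|V(γ)|` (`tsum_cut_card_gt`).

Finally `T ≥ J |γ|`, as every incorrect site has a neighbour with another spin; the coupling of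
`sp(γ)` to all sites is at most a multiple of `|γ|`; and a pair that leaves `I_n(γ)` or `I'(γ)` either
ends in `sp(γ)` or has `h x ≠ h y` (`sum_surfaceEnergy_le`). So every term on the right-hand side is at
most a multiple of `T`.
-/

namespace LongRange

/-! ### Geodesics and closed 1-cochains on the lattice -/

/-- The `i`-th unit vector of `ℤ^d`. -/
def unitVec {d : ℕ} (i : Fin d) : Fin d → ℤ := Pi.single i 1

theorem l1dist_self {d : ℕ} (x : Fin d → ℤ) : l1dist x x = 0 := by simp [l1dist]

theorem l1dist_eq_zero {d : ℕ} {x y : Fin d → ℤ} : l1dist x y = 0 ↔ x = y := by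
  refine ⟨fun h => funext fun i => ?_, fun h => h ▸ l1dist_self x⟩
  have := (Finset.sum_eq_zero_iff.1 h) i (Finset.mem_univ i)
  omega

theorem l1dist_triangle {d : ℕ} (x y z : Fin d → ℤ) :
    l1dist x z ≤ l1dist x y + l1dist y z := by
  unfold l1dist
  rw [← Finset.sum_add_distrib]
  exact Finset.sum_le_sum fun i _ => by omega

theorem l1dist_add_smul_unitVec {d : ℕ} (x : Fin d → ℤ) (i : Fin d) (e : ℤ) :
    l1dist x (x + e • unitVec i) = e.natAbs := by
  unfold l1dist
  rw [Finset.sum_eq_single i]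
  · simp [unitVec]
  · intro j _ hj
    simp [unitVec, hj]
  · simp

theorem l1dist_add_unitVec {d : ℕ} (x : Fin d → ℤ) (i : Fin d) :
    l1dist x (x + unitVec i) = 1 := by
  simpa using l1dist_add_smul_unitVec x i 1

/-- Every site `x ≠ y` has a nearest neighbour that is one step closer to `y`. -/
theorem exists_step {d : ℕ} {x y : Fin d → ℤ} (h : x ≠ y) :
    ∃ x', l1dist x x' = 1 ∧ l1dist x' y + 1 = l1dist x y ∧
      ∃ i, x' = x + unitVec i ∨ x = x' + unitVec i := by
  obtain ⟨i, hi⟩ := Function.ne_iff.1 h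
  have key : ∀ e : ℤ, e.natAbs = 1 → (x i + e - y i).natAbs + 1 = (x i - y i).natAbs →
      l1dist x (x + e • unitVec i) = 1 ∧ l1dist (x + e • unitVec i) y + 1 = l1dist x y := by
    intro e he h1
    refine ⟨by rw [l1dist_add_smul_unitVec, he], ?_⟩
    unfold l1dist
    rw [← Finset.add_sum_erase _ _ (Finset.mem_univ i),
      ← Finset.add_sum_erase Finset.univ (fun j => (x j - y j).natAbs) (Finset.mem_univ i)]
    have : ∑ j ∈ Finset.univ.erase i, ((x + e • unitVec i) j - y j).natAbs =
        ∑ j ∈ Finset.univ.erase i, (x j - y j).natAbs :=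
      Finset.sum_congr rfl fun j hj => by simp [unitVec, Finset.ne_of_mem_erase hj]
    rw [this]
    have h2 : (x + e • unitVec i) i = x i + e := by simp [unitVec]
    rw [h2]
    omega
  rcases lt_or_gt_of_ne hi with hlt | hgt
  · obtain ⟨h1, h2⟩ := key 1 rfl (by omega)
    exact ⟨_, h1, h2, i, Or.inl (by simp)⟩
  · obtain ⟨h1, h2⟩ := key (-1) rfl (by omega)
    exact ⟨_, h1, h2, i, Or.inr (by simp)⟩

theorem exists_unitVec_of_l1dist_eq_one {d : ℕ} {x y : Fin d → ℤ} (h : l1dist x y = 1) :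
    ∃ i, y = x + unitVec i ∨ x = y + unitVec i := by
  have hne : x ≠ y := fun h' => by simp [h', l1dist_self] at h
  obtain ⟨x', h1, h2, h3⟩ := exists_step hne
  have : x' = y := l1dist_eq_zero.1 (by omega)
  rwa [this] at h3

/-- A function that is constant along the edges of a ball takes the value at the centre on the
whole ball. -/
theorem eq_of_edge_const_on_ball {d : ℕ} {β : Type*} {f : (Fin d → ℤ) → β} {y : Fin d → ℤ} {R : ℕ}
    (hf : ∀ u v, l1dist u y ≤ R → l1dist v y ≤ R → l1dist u v = 1 → f u = f v)
    (x : Fin d → ℤ) (hx : l1dist x y ≤ R) : f x = f y := by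
  induction hn : l1dist x y generalizing x with
  | zero => rw [l1dist_eq_zero.1 hn]
  | succ n ih =>
    have hne : x ≠ y := fun h' => by simp [h', l1dist_self] at hn
    obtain ⟨x', h1, h2, -⟩ := exists_step hne
    rw [hf x x' hx (by omega) h1]
    exact ih x' (by omega) (by omega)

theorem eq_of_edge_const {d : ℕ} {β : Type*} {f : (Fin d → ℤ) → β}
    (hf : ∀ u v, l1dist u v = 1 → f u = f v) (x y : Fin d → ℤ) : f x = f y :=
  eq_of_edge_const_on_ball (R := l1dist x y) (fun u v _ _ => hf u v) x le_rfl

/-- Every function on `ℤ` is a discrete derivative. -/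
theorem exists_int_primitive {G : Type*} [AddCommGroup G] (F : ℤ → G) :
    ∃ P : ℤ → G, ∀ t, P (t + 1) - P t = F t := by
  refine ⟨fun t => ∑ k ∈ Finset.range t.toNat, F k -
    ∑ k ∈ Finset.range (-t).toNat, F (-k - 1), fun t => ?_⟩
  rcases le_or_gt 0 t with h | h
  · obtain ⟨n, rfl⟩ := Int.eq_ofNat_of_zero_le h
    have e1 : ((n : ℤ) + 1).toNat = n + 1 := by omega
    have e2 : (-((n : ℤ) + 1)).toNat = 0 := by omega
    have e3 : (-(n : ℤ)).toNat = 0 := by omega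
    simp only [e1, e2, e3, Int.toNat_natCast, Finset.sum_range_succ, Finset.range_zero,
      Finset.sum_empty]
    abel
  · obtain ⟨n, rfl⟩ : ∃ n : ℕ, t = -(n : ℤ) - 1 := ⟨(-t - 1).toNat, by omega⟩
    have e1 : (-(n : ℤ) - 1 + 1).toNat = 0 := by omega
    have e2 : (-(-(n : ℤ) - 1 + 1)).toNat = n := by omega
    have e3 : (-(-(n : ℤ) - 1)).toNat = n + 1 := by omega
    have e4 : (-(n : ℤ) - 1).toNat = 0 := by omega
    simp only [e1, e2, e3, e4, Finset.sum_range_succ, Finset.range_zero, Finset.sum_empty]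
    abel

/-- A 1-cochain on `ℤ^d` (with `ω i x` the value on the edge from `x` to `x + e_i`) that is closed
on the unit squares is exact: the first cohomology of the lattice vanishes. -/
theorem exists_primitive_of_closed {d : ℕ} {G : Type*} [AddCommGroup G]
    (ω : Fin d → (Fin d → ℤ) → G)
    (hω : ∀ i j x, i ≠ j → ω i x + ω j (x + unitVec i) = ω j x + ω i (x + unitVec j)) :
    ∃ h : (Fin d → ℤ) → G, ∀ i x, h (x + unitVec i) - h x = ω i x := by
  -- Integrate in one direction after the other; closedness keeps the directions already done.
  have key : ∀ k : ℕ, ∃ h : (Fin d → ℤ) → G, ∀ (i : Fin d) x, (i : ℕ) < k →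
      h (x + unitVec i) - h x = ω i x := by
    intro k
    induction k with
    | zero => exact ⟨0, fun i x hi => absurd hi (Nat.not_lt_zero _)⟩
    | succ k ih =>
      obtain ⟨h, hh⟩ := ih
      by_cases hk : k < d
      swap
      · exact ⟨h, fun i x _ => hh i x (by omega)⟩
      let κ : Fin d := ⟨k, hk⟩
      let F : (Fin d → ℤ) → ℤ → G := fun x t =>
        ω κ (Function.update x κ t) -
          (h (Function.update x κ t + unitVec κ) - h (Function.update x κ t))
      choose P hP using fun x => exists_int_primitive (F x)
      let Q : (Fin d → ℤ) → ℤ → G := fun x t => P x t - P x 0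
      have hQ : ∀ x y, F x = F y → ∀ t, Q x t = Q y t := by
        intro x y hxy t
        have hd : ∀ t, P x (t + 1) - P y (t + 1) = P x t - P y t := fun t => by
          have h1 := hP x t
          have h2 := hP y t
          rw [hxy, ← h2] at h1
          rw [sub_eq_sub_iff_add_eq_add] at h1 ⊢
          rw [h1]; abel
        have hc : ∀ t, P x t - P y t = P x 0 - P y 0 := fun t => by
          induction t using Int.induction_on with
          | zero => rfl
          | succ i ih => rw [hd, ih]
          | pred i ih => rw [← ih, ← hd (-(i : ℤ) - 1)]; simp
        have := hc t
        simp only [Q]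
        rw [sub_eq_sub_iff_add_eq_add] at this ⊢
        rw [this]; abel
      refine ⟨fun x => h x + Q x (x κ), fun i x hi => ?_⟩
      rcases Nat.lt_succ_iff_lt_or_eq.1 hi with hlt | heq
      · have hne : i ≠ κ := fun h' => by simp [h', κ] at hlt
        have hF : F (x + unitVec i) = F x := by
          funext t
          have e1 : Function.update (x + unitVec i) κ t = Function.update x κ t + unitVec i := by
            funext j
            by_cases hj : j = κ
            · subst hj; simp [unitVec, hne.symm]
            · simp [hj]
          set z := Function.update x κ t
          have c := hω i κ z hne
          have c1 := hh i z hlt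
          have c2 := hh i (z + unitVec κ) hlt
          simp only [F, e1]
          change ω κ (z + unitVec i) - (h (z + unitVec i + unitVec κ) - h (z + unitVec i)) =
            ω κ z - (h (z + unitVec κ) - h z)
          rw [add_right_comm z (unitVec i)]
          rw [← c1, ← c2] at c
          have c' := congrArg
            (fun g => g - (h (z + unitVec i) - h z) - (h (z + unitVec κ + unitVec i) -
              h (z + unitVec i))) c
          simp only at c'
          calc _ = h (z + unitVec i) - h z + ω κ (z + unitVec i) - (h (z + unitVec i) - h z) -
                (h (z + unitVec κ + unitVec i) - h (z + unitVec i)) := by abel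
            _ = _ := by rw [c']; abel
        have e2 : (x + unitVec i) κ = x κ := by simp [unitVec, hne.symm]
        beta_reduce
        rw [e2, hQ _ _ hF]
        have := hh i x hlt
        rw [← this]; abel
      · have hiκ : i = κ := Fin.ext heq
        subst hiκ
        have hF : F (x + unitVec κ) = F x := by
          funext t
          have e1 : Function.update (x + unitVec κ) κ t = Function.update x κ t := by
            funext j
            by_cases hj : j = κ
            · subst hj; simp
            · simp [hj, unitVec]
          simp only [F, e1]
        have e2 : (x + unitVec κ) κ = x κ + 1 := by simp [unitVec]
        beta_reduce
        rw [e2, hQ _ _ hF]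
        have h1 := hP x (x κ)
        have h2 : F x (x κ) = ω κ x - (h (x + unitVec κ) - h x) := by simp [F]
        rw [h2] at h1
        have h3 : Q x (x κ + 1) - Q x (x κ) = P x (x κ + 1) - P x (x κ) := by
          simp only [Q]; abel
        rw [← h3] at h1
        calc _ = (Q x (x κ + 1) - Q x (x κ)) + (h (x + unitVec κ) - h x) := by abel
          _ = _ := by rw [h1]; abel
  obtain ⟨h, hh⟩ := key d
  exact ⟨h, fun i x => hh i x i.2⟩

/-! ### Components and volumes -/

theorem subset_vol {d : ℕ} (A : Set (Fin d → ℤ)) : A ⊆ vol A := fun x hx => by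
  have : component Aᶜ x = ∅ := Set.eq_empty_iff_forall_notMem.2 fun y ⟨h, _, _⟩ => h hx
  simp [vol, this]

theorem mem_component_self {d : ℕ} {S : Set (Fin d → ℤ)} {x : Fin d → ℤ} (hx : x ∈ S) :
    x ∈ component S x := ⟨hx, hx, SimpleGraph.Reachable.refl _⟩

theorem component_subset_of_mem {d : ℕ} {S : Set (Fin d → ℤ)} {x y : Fin d → ℤ}
    (h : y ∈ component S x) : component S y ⊆ component S x := by
  obtain ⟨hx, hy, hxy⟩ := h
  rintro z ⟨_, hz, hyz⟩
  exact ⟨hx, hz, hxy.trans hyz⟩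

theorem mem_component_of_adj {d : ℕ} {S : Set (Fin d → ℤ)} {x y z : Fin d → ℤ}
    (h : y ∈ component S x) (hz : z ∈ S) (hyz : l1dist y z = 1) : z ∈ component S x := by
  obtain ⟨hx, hy, hxy⟩ := h
  exact ⟨hx, hz, hxy.trans (SimpleGraph.Adj.reachable (G := (lattice d).induce S) hyz)⟩

/-- A function that is constant along the edges of `S` is constant on the components of `S`. -/
theorem eq_of_mem_component {d : ℕ} {β : Type*} {S : Set (Fin d → ℤ)} {f : (Fin d → ℤ) → β}
    (hf : ∀ u ∈ S, ∀ v ∈ S, l1dist u v = 1 → f u = f v) {x y : Fin d → ℤ}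
    (h : y ∈ component S x) : f y = f x := by
  obtain ⟨hx, hy, ⟨w⟩⟩ := h
  have : ∀ (a b : S) (_ : ((lattice d).induce S).Walk a b), f b = f a := by
    intro a b w
    induction w with
    | nil => rfl
    | cons hadj _ ih => rw [ih]; exact (hf _ (Subtype.prop _) _ (Subtype.prop _) hadj).symm
  exact this _ _ w

/-- A neighbour outside `A` of a site of `vol A` outside `A` is again in `vol A`. -/
theorem mem_vol_of_adj {d : ℕ} {A : Set (Fin d → ℤ)} {x y : Fin d → ℤ} (hx : x ∈ vol A)
    (hxA : x ∉ A) (hyA : y ∉ A) (hxy : l1dist x y = 1) : y ∈ vol A :=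
  Set.Finite.subset hx
    (component_subset_of_mem (mem_component_of_adj (mem_component_self hxA) hyA hxy))

/-- A geodesic that leaves `vol A` meets `A`. -/
theorem exists_mem_geodesic {d : ℕ} {A : Set (Fin d → ℤ)} {y z : Fin d → ℤ} (hy : y ∈ vol A)
    (hz : z ∉ vol A) : ∃ w ∈ A, l1dist y w + l1dist w z = l1dist y z := by
  induction hn : l1dist y z generalizing y with
  | zero => exact absurd (l1dist_eq_zero.1 hn ▸ hy) hz
  | succ n ih =>
    by_cases hyA : y ∈ A
    · exact ⟨y, hyA, by rw [l1dist_self]; omega⟩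
    have hne : y ≠ z := fun h => hz (h ▸ hy)
    obtain ⟨y', h1, h2, -⟩ := exists_step hne
    by_cases hA : y' ∈ A
    · exact ⟨y', hA, by omega⟩
    obtain ⟨w, hw, hwd⟩ := ih (mem_vol_of_adj hy hyA hA h1) (by omega)
    refine ⟨w, hw, le_antisymm ?_ (hn ▸ l1dist_triangle y w z)⟩
    have := l1dist_triangle y y' w
    omega

theorem add_smul_unitVec_injective {d : ℕ} (y : Fin d → ℤ) (i : Fin d) :
    Function.Injective fun k : ℕ => y + (k : ℤ) • unitVec i := fun k l h => by
  have := congrFun h i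
  simpa [unitVec] using this

/-- Every site of `vol A` is within distance `|vol A|` of `A`: otherwise a segment of
`|vol A| + 1` sites would fit into `vol A`. -/
theorem exists_mem_near_of_mem_vol {d : ℕ} (hd : 0 < d) {A : Set (Fin d → ℤ)} (hA : A.Finite)
    {y : Fin d → ℤ} (hy : y ∈ vol A) : ∃ w ∈ A, l1dist y w ≤ (vol A).ncard := by
  let i : Fin d := ⟨0, hd⟩
  obtain ⟨k, hk, hkA⟩ : ∃ k ≤ (vol A).ncard, y + (k : ℤ) • unitVec i ∉ vol A := by
    by_contra! hcon
    have h1 : ((fun k : ℕ => y + (k : ℤ) • unitVec i) ''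
        (Finset.range ((vol A).ncard + 1) : Set ℕ)) ⊆ vol A := by
      rintro _ ⟨k, hk, rfl⟩
      exact hcon k (by simpa [Nat.lt_succ_iff] using hk)
    have h2 := Set.ncard_le_ncard h1 (vol_finite hA)
    rw [Set.ncard_image_of_injective _ (add_smul_unitVec_injective y i),
      Set.ncard_coe_finset, Finset.card_range] at h2
    omega
  obtain ⟨w, hw, hwd⟩ := exists_mem_geodesic hy hkA
  rw [l1dist_add_smul_unitVec] at hwd
  exact ⟨w, hw, by simp at hwd; omega⟩

/-- For `d ≥ 2` the complement of a box is connected. -/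
theorem eq_outside_box {d : ℕ} (hd : 2 ≤ d) {β : Type*} {f : (Fin d → ℤ) → β} {N : ℤ}
    (hf : ∀ u v, (∃ i, N < |u i|) → (∃ i, N < |v i|) → l1dist u v = 1 → f u = f v)
    {x : Fin d → ℤ} (hx : ∃ i, N < |x i|) : f x = f fun _ => |N| + 1 := by
  have hN : N < |(|N| + 1)| := by
    rw [abs_of_nonneg (by positivity)]
    have := le_abs_self N
    omega
  -- Lines in direction `j` stay outside the box while another coordinate is large.
  have line : ∀ (x : Fin d → ℤ) (i j : Fin d), i ≠ j → N < |x i| → ∀ t,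
      f (Function.update x j t) = f x := by
    intro x i j hij hi
    have out : ∀ t, ∃ i, N < |Function.update x j t i| := fun t =>
      ⟨i, by rwa [Function.update_of_ne hij]⟩
    have step : ∀ t, f (Function.update x j (t + 1)) = f (Function.update x j t) := fun t => by
      refine (hf _ _ (out _) (out _) ?_).symm
      have : Function.update x j (t + 1) = Function.update x j t + unitVec j := by
        funext k
        by_cases hk : k = j
        · subst hk; simp [unitVec]
        · simp [hk, unitVec]
      rw [this, l1dist_add_unitVec]
    have all : ∀ t, f (Function.update x j t) = f (Function.update x j 0) := fun t => by
      induction t using Int.induction_on with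
      | zero => rfl
      | succ i ih => rw [step, ih]
      | pred i ih => rw [← ih, ← step (-(i : ℤ) - 1)]; simp
    intro t
    rw [all t, ← all (x j), Function.update_eq_self]
  -- Once coordinate `j` is `|N| + 1`, the other coordinates can be moved there one by one.
  have fill : ∀ (j : Fin d) (s : Finset (Fin d)) (x : Fin d → ℤ), j ∉ s → x j = |N| + 1 →
      f (fun k => if k ∈ s then |N| + 1 else x k) = f x := by
    intro j s
    induction s using Finset.induction_on with
    | empty => intro x _ _; simp
    | insert k s hk ih =>
      intro x hj hxj
      rw [Finset.mem_insert, not_or] at hj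
      rw [← ih x hj.2 hxj, ← line (fun k => if k ∈ s then |N| + 1 else x k) j k hj.1
        (by simp [hj.2, hxj, hN]) (|N| + 1)]
      congr 1
      funext l
      by_cases hl : l = k
      · subst hl; simp
      · simp [hl]
  obtain ⟨i, hi⟩ := hx
  obtain ⟨j, hij⟩ : ∃ j : Fin d, i ≠ j := by
    by_cases h0 : i = ⟨0, by omega⟩
    · exact ⟨⟨1, by omega⟩, by rw [h0]; simp⟩
    · exact ⟨_, h0⟩
  rw [← line x i j hij hi (|N| + 1)]
  have h1 := fill j (Finset.univ.erase j) (Function.update x j (|N| + 1)) (by simp) (by simp)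
  rw [← h1]
  congr 1
  funext k
  by_cases hk : k = j
  · subst hk; simp
  · simp [hk]

theorem exists_box {d : ℕ} {A : Set (Fin d → ℤ)} (hA : A.Finite) :
    ∃ N : ℤ, ∀ x ∈ A, ∀ i, |x i| ≤ N := by
  refine ⟨∑ s ∈ hA.toFinset, ∑ i, |s i|, fun s hs i => ?_⟩
  calc |s i| ≤ ∑ i, |s i| :=
        Finset.single_le_sum (f := fun i => |s i|) (fun _ _ => abs_nonneg _) (Finset.mem_univ i)
    _ ≤ _ := Finset.single_le_sum (f := fun s : Fin d → ℤ => ∑ i, |s i|)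
        (fun _ _ => Finset.sum_nonneg fun _ _ => abs_nonneg _) (hA.mem_toFinset.2 hs)

theorem finite_box {d : ℕ} (N : ℤ) : {x : Fin d → ℤ | ¬ ∃ i, N < |x i|}.Finite := by
  refine (Set.finite_Icc (fun _ : Fin d => -N) (fun _ => N)).subset fun x hx => ?_
  have hx' : ∀ i, |x i| ≤ N := by simpa using hx
  exact ⟨fun i => (abs_le.1 (hx' i)).1, fun i => (abs_le.1 (hx' i)).2⟩

/-- For `d ≥ 2` the complement of `vol A` is a single component of `Aᶜ`, so a function that is
constant along the edges of `Aᶜ` has only one value there. -/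
theorem exists_eq_off_vol {d : ℕ} (hd : 2 ≤ d) {β : Type*} {A : Set (Fin d → ℤ)} (hA : A.Finite)
    {f : (Fin d → ℤ) → β} (hf : ∀ u ∉ A, ∀ v ∉ A, l1dist u v = 1 → f u = f v) :
    ∃ b, ∀ x ∉ vol A, f x = b := by
  obtain ⟨N, hN⟩ := exists_box hA
  have hout : ∀ u : Fin d → ℤ, (∃ i, N < |u i|) → u ∉ A := fun u ⟨i, hi⟩ h =>
    absurd (hN u h i) (not_le.2 hi)
  refine ⟨f fun _ => |N| + 1, fun x hx => ?_⟩
  obtain ⟨y, hy, hyN⟩ := Set.Infinite.exists_notMem_finite (hx : (component Aᶜ x).Infinite)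
    (finite_box N)
  have hyN : ∃ i, N < |y i| := not_not.1 hyN
  rw [← eq_of_mem_component (S := Aᶜ) (fun u hu v hv => hf u hu v hv) hy]
  exact eq_outside_box hd (fun u v hu hv => hf u (hout u hu) v (hout v hv)) hyN

theorem infinite_sites {d : ℕ} (hd : 0 < d) : Infinite (Fin d → ℤ) :=
  Infinite.of_injective _ (add_smul_unitVec_injective 0 ⟨0, hd⟩)

/-! ### The phase function of a contour -/

/-- `h` is the phase function of `S` for the configuration `σ`: its gradient is that of `σ` on the
edges that touch `S` and zero on the other edges, and it vanishes outside `vol S`. When `S` is the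
support of a contour, `h` is what is left of `σ` once all the other contours are removed. -/
structure IsPhase {d q : ℕ} (σ : (Fin d → ℤ) → ZMod q) (S : Set (Fin d → ℤ))
    (h : (Fin d → ℤ) → ZMod q) : Prop where
  touch : ∀ x y, l1dist x y = 1 → (x ∈ S ∨ y ∈ S) → h y - h x = σ y - σ x
  const : ∀ x y, l1dist x y = 1 → x ∉ S → y ∉ S → h x = h y
  off_vol : ∀ x ∉ vol S, h x = 0

theorem eq_of_notMem_boundary {d q : ℕ} {σ : (Fin d → ℤ) → ZMod q} {x y : Fin d → ℤ}
    (hx : x ∉ boundary σ) (hxy : l1dist x y ≤ 1) : σ y = σ x := by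
  obtain ⟨r, hr⟩ := not_not.1 hx
  rw [hr y hxy, hr x (by simp [l1dist_self])]

theorem exists_ne_of_mem_boundary {d q : ℕ} {σ : (Fin d → ℤ) → ZMod q} {x : Fin d → ℤ}
    (hx : x ∈ boundary σ) : ∃ y, l1dist x y = 1 ∧ σ y ≠ σ x := by
  by_contra! hcon
  refine hx ⟨σ x, fun y hy => ?_⟩
  rcases Nat.le_one_iff_eq_zero_or_eq_one.1 hy with h | h
  · rw [l1dist_eq_zero.1 h]
  · exact hcon y h

/-- The gradient of `σ` restricted to the edges that touch `S` is closed, because the other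
incorrect sites are too far from `S` to share a unit square with it; its primitive is the phase
function. -/
theorem exists_isPhase {d q : ℕ} (hd : 2 ≤ d) {σ : (Fin d → ℤ) → ZMod q} {S : Set (Fin d → ℤ)}
    (hS : S.Finite) (hsep : ∀ x ∈ boundary σ, x ∉ S → ∀ s ∈ S, 2 < l1dist x s) :
    ∃ h, IsPhase σ S h := by
  classical
  let W : (Fin d → ℤ) → (Fin d → ℤ) → ZMod q := fun x y =>
    if x ∈ S ∨ y ∈ S then σ y - σ x else 0
  -- On a unit square that meets `S`, the cochain is the gradient of `σ`.
  have hW : ∀ s ∈ S, ∀ x y, l1dist x s ≤ 2 → l1dist x y = 1 → W x y = σ y - σ x := by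
    intro s hs x y hxs hxy
    by_cases h : x ∈ S ∨ y ∈ S
    · simp only [W, if_pos h]
    · simp only [W, if_neg h]
      rw [not_or] at h
      have hx : x ∉ boundary σ := fun hx => absurd (hsep x hx h.1 s hs) (by omega)
      rw [eq_of_notMem_boundary hx hxy.le, sub_self]
  obtain ⟨h, hh⟩ := exists_primitive_of_closed (fun i x => W x (x + unitVec i)) (by
    intro i j x _
    have e1 := l1dist_add_unitVec x i
    have e2 := l1dist_add_unitVec x j
    have e3 := l1dist_add_unitVec (x + unitVec i) j
    have e4 := l1dist_add_unitVec (x + unitVec j) i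
    have e4' := e4
    rw [add_right_comm x (unitVec j)] at e4'
    by_cases hs : ∃ s ∈ S, s = x ∨ s = x + unitVec i ∨ s = x + unitVec j ∨
        s = x + unitVec i + unitVec j
    · obtain ⟨s, hs, hcase⟩ := hs
      have c1 := l1dist_comm x (x + unitVec i)
      have c2 := l1dist_comm x (x + unitVec j)
      have t1 := l1dist_triangle x (x + unitVec i) (x + unitVec i + unitVec j)
      have t2 := l1dist_triangle (x + unitVec i) x (x + unitVec j)
      have t3 := l1dist_triangle (x + unitVec j) x (x + unitVec i)
      have hx : l1dist x s ≤ 2 ∧ l1dist (x + unitVec i) s ≤ 2 ∧ l1dist (x + unitVec j) s ≤ 2 := by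
        rcases hcase with rfl | rfl | rfl | rfl <;>
          refine ⟨?_, ?_, ?_⟩ <;> first | omega | simp [l1dist_self]
      rw [hW s hs _ _ hx.1 e1, hW s hs _ _ hx.1 e2, hW s hs _ _ hx.2.1 e3,
        hW s hs _ _ hx.2.2 e4, add_right_comm x (unitVec j)]
      abel
    · push Not at hs
      have g : ∀ s, (s = x ∨ s = x + unitVec i ∨ s = x + unitVec j ∨
          s = x + unitVec i + unitVec j) → s ∉ S := fun s hc hsS => by
        have := hs s hsS
        tauto
      have g1 := g _ (Or.inl rfl)
      have g2 := g _ (Or.inr (Or.inl rfl))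
      have g3 := g _ (Or.inr (Or.inr (Or.inl rfl)))
      have g4 := g _ (Or.inr (Or.inr (Or.inr rfl)))
      have g4' := g4
      rw [add_right_comm x (unitVec i)] at g4'
      simp only [W, g1, g2, g3, g4, g4', or_self, if_false])
  have hgrad : ∀ x y, l1dist x y = 1 → h y - h x = W x y := by
    intro x y hxy
    obtain ⟨i, rfl | rfl⟩ := exists_unitVec_of_l1dist_eq_one hxy
    · exact hh i x
    · have h1 := hh i y
      have h2 : W (y + unitVec i) y = -W y (y + unitVec i) := by
        simp only [W, or_comm (a := y ∈ S)]
        split_ifs <;> simp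
      rw [h2, ← h1, neg_sub]
  have hconst : ∀ x y, l1dist x y = 1 → x ∉ S → y ∉ S → h x = h y := fun x y hxy hx hy => by
    have := hgrad x y hxy
    simp only [W, hx, hy, or_self, if_false] at this
    exact (sub_eq_zero.1 this).symm
  obtain ⟨b, hb⟩ := exists_eq_off_vol hd hS (f := h) fun u hu v hv huv => hconst u v huv hu hv
  refine ⟨fun x => h x - b, fun x y hxy hS => ?_, fun x y hxy hx hy => ?_, fun x hx => ?_⟩
  · rw [sub_sub_sub_cancel_right, hgrad x y hxy]
    simp only [W, if_pos hS]
  · rw [hconst x y hxy hx hy]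
  · simp [hb x hx]

/-- A configuration is the sum of the phase functions of the parts of its boundary: the gradients
agree, and both sides vanish far away. -/
theorem eq_sum_phase {d q : ℕ} (hd : 2 ≤ d) {Λ : Finset (Fin d → ℤ)} {σ : (Fin d → ℤ) → ZMod q}
    (hσ : σ ∈ configs Λ 0) {A : Finset (Fin d → ℤ)} (hA : (A : Set (Fin d → ℤ)) = boundary σ)
    (P : Finpartition A)
    (hsep : ∀ B ∈ P.parts, ∀ C ∈ P.parts, B ≠ C → ∀ x ∈ B, ∀ y ∈ C, 2 < l1dist x y)
    {h : Finset (Fin d → ℤ) → (Fin d → ℤ) → ZMod q}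
    (hh : ∀ B ∈ P.parts, IsPhase σ (B : Set (Fin d → ℤ)) (h B)) (x : Fin d → ℤ) :
    σ x = ∑ B ∈ P.parts, h B x := by
  have hgrad : ∀ x y, l1dist x y = 1 →
      σ x - ∑ B ∈ P.parts, h B x = σ y - ∑ B ∈ P.parts, h B y := by
    intro x y hxy
    suffices hs : ∑ B ∈ P.parts, (h B y - h B x) = σ y - σ x by
      rw [Finset.sum_sub_distrib] at hs
      rw [sub_eq_sub_iff_add_eq_add]
      rw [sub_eq_sub_iff_add_eq_add] at hs
      rw [add_comm, hs]
    by_cases hex : ∃ B ∈ P.parts, x ∈ B ∨ y ∈ B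
    · obtain ⟨B, hB, hxB⟩ := hex
      rw [Finset.sum_eq_single_of_mem B hB, (hh B hB).touch x y hxy (by exact_mod_cast hxB)]
      intro C hC hCB
      have hyx : l1dist y x = 1 := by rw [l1dist_comm, hxy]
      have : x ∉ C ∧ y ∉ C := by
        rcases hxB with hb | hb
        · exact ⟨fun hc => absurd (hsep C hC B hB hCB _ hc _ hb) (by simp [l1dist_self]),
            fun hc => absurd (hsep C hC B hB hCB _ hc _ hb) (by omega)⟩
        · exact ⟨fun hc => absurd (hsep C hC B hB hCB _ hc _ hb) (by omega),
            fun hc => absurd (hsep C hC B hB hCB _ hc _ hb) (by simp [l1dist_self])⟩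
      rw [(hh C hC).const x y hxy (by exact_mod_cast this.1) (by exact_mod_cast this.2), sub_self]
    · push Not at hex
      have hx : x ∉ boundary σ := fun hx => by
        rw [← hA] at hx
        obtain ⟨B, hB, hxB⟩ := P.exists_mem (Finset.mem_coe.1 hx)
        exact (hex B hB).1 hxB
      rw [eq_of_notMem_boundary hx hxy.le, sub_self]
      refine Finset.sum_eq_zero fun B hB => ?_
      rw [(hh B hB).const x y hxy (by exact_mod_cast (hex B hB).1)
        (by exact_mod_cast (hex B hB).2), sub_self]
  have hfin : ((Λ : Set (Fin d → ℤ)) ∪ ⋃ B ∈ P.parts, vol (B : Set (Fin d → ℤ))).Finite :=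
    Λ.finite_toSet.union (Set.Finite.biUnion P.parts.finite_toSet
      fun B _ => vol_finite B.finite_toSet)
  have := infinite_sites (d := d) (by omega)
  obtain ⟨z, hz⟩ := hfin.exists_notMem
  simp only [Set.mem_union, Set.mem_iUnion, not_or, not_exists, Finset.mem_coe] at hz
  have h0 := eq_of_edge_const (f := fun x => σ x - ∑ B ∈ P.parts, h B x) hgrad x z
  beta_reduce at h0
  rw [hσ z hz.1, Finset.sum_eq_zero fun B hB => (hh B hB).off_vol z (hz.2 B hB), sub_zero] at h0
  exact sub_eq_zero.1 h0

/-- The phase function is constant on a ball that misses `S`. -/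
theorem IsPhase.eq_of_ball {d q : ℕ} {σ : (Fin d → ℤ) → ZMod q} {S : Set (Fin d → ℤ)}
    {h : (Fin d → ℤ) → ZMod q} (hh : IsPhase σ S h) {y : Fin d → ℤ} {R : ℕ}
    (hy : ∀ s ∈ S, R < l1dist s y) {x : Fin d → ℤ} (hx : l1dist x y ≤ R) : h x = h y :=
  eq_of_edge_const_on_ball (fun u v hu hv huv => hh.const u v huv
    (fun hs => absurd (hy u hs) (not_lt.2 hu)) (fun hs => absurd (hy v hs) (not_lt.2 hv))) x hx

namespace Contour

variable {d q : ℕ}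

/-- The labels are the values of the phase function: on the interior of an isolated contour on
which `σ` and the phase function agree, `I_n` is the set where the phase function is `n`. -/
theorem mem_interiorLabel_phase (hd : 2 ≤ d) {γ : Contour d q} {σ h : (Fin d → ℤ) → ZMod q}
    (hspin : ∀ x : γ.sp, γ.spin x = σ x)
    (hsep : ∀ x ∈ boundary σ, x ∉ (γ.sp : Set (Fin d → ℤ)) →
      ∀ s ∈ (γ.sp : Set (Fin d → ℤ)), 2 < l1dist x s)
    (hh : IsPhase σ (γ.sp : Set (Fin d → ℤ)) h) (hext : ∀ x ∈ γ.sp, σ x = h x)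
    {x : Fin d → ℤ} (hx : x ∈ γ.interior) : x ∈ γ.interiorLabel (h x) := by
  set S : Set (Fin d → ℤ) := (γ.sp : Set (Fin d → ℤ)) with hS
  set C := component γ.interior x with hC
  have hCI : C ⊆ γ.interior := fun y hy => hy.2.1
  have hCfin : C.Finite := ((vol_finite γ.sp.finite_toSet).subset Set.sdiff_subset).subset hCI
  have hxC : x ∈ C := mem_component_self hx
  refine ⟨hx, ?_, ?_⟩
  · have := infinite_sites (d := d) (by omega)
    obtain ⟨z, hz⟩ := (vol_finite hCfin).exists_notMem
    by_contra hcon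
    rw [Set.not_nonempty_iff_eq_empty, Set.eq_empty_iff_forall_notMem] at hcon
    have := eq_of_edge_const (f := fun u => u ∈ vol C) (fun u v huv => by
      refine propext ⟨fun hu => ?_, fun hv => ?_⟩
      · by_contra hv
        exact hcon v ⟨hv, u, hu, huv⟩
      · by_contra hu
        exact hcon u ⟨hu, v, hv, by rw [l1dist_comm]; exact huv⟩) x z
    beta_reduce at this
    exact hz (this ▸ subset_vol C hxC)
  · rintro y ⟨hyC, u, hu, huy⟩
    have hyC' : y ∉ C := fun h => hyC (subset_vol C h)
    have huC : u ∈ C := by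
      by_contra huC
      exact hyC (mem_vol_of_adj hu huC hyC' huy)
    have hyI : y ∉ γ.interior := fun hyI => hyC' (mem_component_of_adj huC hyI huy)
    have hyS : y ∈ S := by
      by_contra hyS
      exact hyI ⟨mem_vol_of_adj (hCI huC).1 (hCI huC).2 hyS huy, hyS⟩
    refine ⟨by exact_mod_cast hyS, ?_⟩
    rw [hspin, hext y (by exact_mod_cast hyS)]
    have hub : u ∉ boundary σ := fun hub =>
      absurd (hsep u hub (hCI huC).2 y hyS) (by omega)
    have h1 := hh.touch u y huy (Or.inr hyS)
    rw [eq_of_notMem_boundary hub huy.le, sub_self] at h1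
    rw [sub_eq_zero.1 h1]
    exact eq_of_mem_component (fun a ha b hb hab => hh.const a b hab ha.2 hb.2) huC

theorem mem_interiorLabel_iff (hd : 2 ≤ d) {γ : Contour d q} {σ h : (Fin d → ℤ) → ZMod q}
    (hspin : ∀ x : γ.sp, γ.spin x = σ x)
    (hsep : ∀ x ∈ boundary σ, x ∉ (γ.sp : Set (Fin d → ℤ)) →
      ∀ s ∈ (γ.sp : Set (Fin d → ℤ)), 2 < l1dist x s)
    (hh : IsPhase σ (γ.sp : Set (Fin d → ℤ)) h) (hext : ∀ x ∈ γ.sp, σ x = h x)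
    {x : Fin d → ℤ} {n : ZMod q} : x ∈ γ.interiorLabel n ↔ x ∈ γ.interior ∧ h x = n := by
  refine ⟨fun hx => ⟨hx.1, ?_⟩, ?_⟩
  · exact γ.interiorLabel_unique (γ.mem_interiorLabel_phase hd hspin hsep hh hext hx.1) hx
  · rintro ⟨hx, rfl⟩
    exact γ.mem_interiorLabel_phase hd hspin hsep hh hext hx

/-- Erasing an isolated contour on which `σ` and the phase function agree amounts to subtracting
the phase function. -/
theorem erase_eq_sub (hd : 2 ≤ d) {γ : Contour d q} {σ h : (Fin d → ℤ) → ZMod q}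
    (hspin : ∀ x : γ.sp, γ.spin x = σ x)
    (hsep : ∀ x ∈ boundary σ, x ∉ (γ.sp : Set (Fin d → ℤ)) →
      ∀ s ∈ (γ.sp : Set (Fin d → ℤ)), 2 < l1dist x s)
    (hh : IsPhase σ (γ.sp : Set (Fin d → ℤ)) h) (hext : ∀ x ∈ γ.sp, σ x = h x)
    (x : Fin d → ℤ) : γ.erase σ x = σ x - h x := by
  by_cases hxS : x ∈ γ.sp
  · simp [erase, hxS, hext x hxS]
  by_cases hxV : x ∈ vol (γ.sp : Set (Fin d → ℤ))
  · exact γ.erase_of_mem_interiorLabel σ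
      (γ.mem_interiorLabel_phase hd hspin hsep hh hext ⟨hxV, by exact_mod_cast hxS⟩)
  · have hno : ¬ ∃ n : ZMod q, x ∈ γ.interiorLabel n := fun ⟨n, hn⟩ => hxV hn.1.1
    simp [erase, hxS, hno, hh.off_vol x hxV]

end Contour

/-- If `Λᶜ` is connected, the phase function vanishes outside `Λ`: its gradient is zero there, and
it vanishes far away. -/
theorem IsPhase.eq_zero_of_connected {d q : ℕ} (hd : 2 ≤ d) {Λ : Finset (Fin d → ℤ)}
    {σ : (Fin d → ℤ) → ZMod q} (hσ : σ ∈ configs Λ 0) {S : Set (Fin d → ℤ)} (hS : S.Finite)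
    {h : (Fin d → ℤ) → ZMod q} (hh : IsPhase σ S h)
    (hΛ : ((lattice d).induce ((Λ : Set (Fin d → ℤ))ᶜ)).Connected) {x : Fin d → ℤ}
    (hx : x ∉ Λ) : h x = 0 := by
  have := infinite_sites (d := d) (by omega)
  obtain ⟨z, hz⟩ := (Λ.finite_toSet.union (vol_finite hS)).exists_notMem
  rw [Set.mem_union, not_or] at hz
  rw [← hh.off_vol z hz.2]
  refine (eq_of_mem_component (S := (Λ : Set (Fin d → ℤ))ᶜ) (fun u hu v hv huv => ?_)
    ⟨by exact_mod_cast hx, hz.1, hΛ.preconnected _ _⟩).symm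
  by_cases hS : u ∈ S ∨ v ∈ S
  · have := hh.touch u v huv hS
    rw [hσ u (by exact_mod_cast hu), hσ v (by exact_mod_cast hv), sub_self] at this
    exact (sub_eq_zero.1 this).symm
  · rw [not_or] at hS
    exact hh.const u v huv hS.1 hS.2

/-! ### Double sums of the coupling -/

section Sums

variable {d : ℕ} {J α : ℝ}

theorem coupling_nonneg (hJ : 0 ≤ J) (x y : Fin d → ℤ) : 0 ≤ coupling J α x y := by
  unfold coupling
  split_ifs
  · exact le_rfl
  · positivity

theorem coupling_comm (x y : Fin d → ℤ) : coupling J α x y = coupling J α y x := by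
  unfold coupling
  simp only [eq_comm, l1dist_comm]

theorem coupling_of_l1dist_eq_one {x y : Fin d → ℤ} (h : l1dist x y = 1) :
    coupling J α x y = J := by
  have : x ≠ y := fun h' => by simp [h', l1dist_self] at h
  simp [coupling, this, h]

theorem tsum_coupling (x : Fin d → ℤ) :
    ∑' y, coupling J α x y = ∑' y : Fin d → ℤ, coupling J α 0 y := by
  rw [← (Equiv.addLeft x).tsum_eq (fun y => coupling J α x y)]
  refine tsum_congr fun y => ?_
  simp [coupling, l1dist, Equiv.coe_addLeft, eq_comm (a := y)]

open Classical in
theorem hasSum_pair_of_fst_mem (hJ : 0 ≤ J) (hα : (d : ℝ) < α) (A : Finset (Fin d → ℤ)) :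
    HasSum (fun p : (Fin d → ℤ) × (Fin d → ℤ) => if p.1 ∈ A then coupling J α p.1 p.2 else 0)
      (A.card * ∑' y : Fin d → ℤ, coupling J α 0 y) := by
  have hrow : ∀ x : Fin d → ℤ, Summable fun y =>
      if x ∈ A then coupling J α x y else 0 := fun x => by
    by_cases hx : x ∈ A
    · simpa [hx] using summable_coupling hα x
    · simp [hx]
  have hout : ∀ x, x ∉ A → (∑' y, if x ∈ A then coupling J α x y else 0) = 0 := fun x hx => by
    simp [hx]
  have hs : Summable fun p : (Fin d → ℤ) × (Fin d → ℤ) =>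
      if p.1 ∈ A then coupling J α p.1 p.2 else 0 := by
    refine (summable_prod_of_nonneg fun p => ?_).2
      ⟨hrow, summable_of_ne_finset_zero (s := A) fun x hx => hout x hx⟩
    simp only [Pi.zero_apply]
    split_ifs
    · exact coupling_nonneg hJ _ _
    · exact le_rfl
  convert hs.hasSum using 1
  rw [hs.tsum_prod, tsum_eq_sum (s := A) fun x hx => hout x hx, ← nsmul_eq_mul]
  refine (Finset.sum_eq_card_nsmul fun x hx => ?_).symm
  simp only [if_pos hx, tsum_coupling]

open Classical in
theorem hasSum_pair_of_snd_mem (hJ : 0 ≤ J) (hα : (d : ℝ) < α) (A : Finset (Fin d → ℤ)) :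
    HasSum (fun p : (Fin d → ℤ) × (Fin d → ℤ) => if p.2 ∈ A then coupling J α p.1 p.2 else 0)
      (A.card * ∑' y : Fin d → ℤ, coupling J α 0 y) := by
  have := (Equiv.prodComm (Fin d → ℤ) (Fin d → ℤ)).hasSum_iff.2
    (hasSum_pair_of_fst_mem hJ hα A)
  refine this.congr_fun fun p => ?_
  simp [coupling_comm p.1]

open Classical in
theorem surfaceEnergy_eq (A : Set (Fin d → ℤ)) :
    surfaceEnergy J α A = ∑' p : (Fin d → ℤ) × (Fin d → ℤ),
      if p.1 ∈ A ∧ p.2 ∉ A then coupling J α p.1 p.2 else 0 := by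
  have h1 : surfaceEnergy J α A = ∑' p : ↥(A ×ˢ Aᶜ), coupling J α p.1.1 p.1.2 :=
    ((Equiv.Set.prod A Aᶜ).tsum_eq fun p : ↥A × ↥Aᶜ => coupling J α p.1.1 p.2.1).symm
  rw [h1, tsum_subtype (A ×ˢ Aᶜ)
    (fun p : (Fin d → ℤ) × (Fin d → ℤ) => coupling J α p.1 p.2)]
  refine tsum_congr fun p => ?_
  simp [Set.indicator, Set.mem_prod]

/-- The coupling of an ordered pair of sites on which `h` disagrees, and zero for the other pairs. -/
noncomputable def cut {β : Type*} [DecidableEq β] (J α : ℝ) (h : (Fin d → ℤ) → β)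
    (p : (Fin d → ℤ) × (Fin d → ℤ)) : ℝ :=
  if h p.1 = h p.2 then 0 else coupling J α p.1 p.2

variable {β : Type*} [DecidableEq β] {h : (Fin d → ℤ) → β}

theorem cut_nonneg (hJ : 0 ≤ J) (p : (Fin d → ℤ) × (Fin d → ℤ)) : 0 ≤ cut J α h p := by
  unfold cut
  split_ifs
  · exact le_rfl
  · exact coupling_nonneg hJ _ _

theorem cut_le (hJ : 0 ≤ J) (p : (Fin d → ℤ) × (Fin d → ℤ)) :
    cut J α h p ≤ coupling J α p.1 p.2 := by
  unfold cut
  split_ifs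
  · exact coupling_nonneg hJ _ _
  · exact le_rfl

theorem cut_swap (p : (Fin d → ℤ) × (Fin d → ℤ)) : cut J α h p.swap = cut J α h p := by
  unfold cut
  simp only [Prod.fst_swap, Prod.snd_swap, eq_comm, coupling_comm p.1]

theorem summable_cut (hJ : 0 ≤ J) (hα : (d : ℝ) < α) {b : β} (U : Finset (Fin d → ℤ))
    (hU : ∀ x ∉ U, h x = b) : Summable (cut J α h) := by
  classical
  refine Summable.of_nonneg_of_le (cut_nonneg hJ) (fun p => ?_)
    ((hasSum_pair_of_fst_mem hJ hα U).summable.add (hasSum_pair_of_snd_mem hJ hα U).summable)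
  have := coupling_nonneg (α := α) hJ p.1 p.2
  by_cases h1 : p.1 ∈ U
  · rw [if_pos h1]
    refine (cut_le hJ p).trans (le_add_of_nonneg_right ?_)
    split_ifs <;> simp [this]
  · by_cases h2 : p.2 ∈ U
    · rw [if_pos h2, if_neg h1, zero_add]
      exact cut_le hJ p
    · simp [cut, hU _ h1, hU _ h2, h1, h2]

end Sums

/-! ### The energy as a sum over ordered pairs -/

section Energy

variable {d q : ℕ} {J α : ℝ}

open Classical in
/-- The multiplicity with which an ordered pair of sites enters the energy in `Λ`. -/
noncomputable def pairWeight (Λ : Finset (Fin d → ℤ)) (p : (Fin d → ℤ) × (Fin d → ℤ)) : ℝ :=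
  if p.1 ∈ Λ then (if p.2 ∈ Λ then 1 / 2 else 1) else 0

theorem pairWeight_nonneg (Λ : Finset (Fin d → ℤ)) (p : (Fin d → ℤ) × (Fin d → ℤ)) :
    0 ≤ pairWeight Λ p := by
  unfold pairWeight
  split_ifs <;> norm_num

theorem pairWeight_le_one (Λ : Finset (Fin d → ℤ)) (p : (Fin d → ℤ) × (Fin d → ℤ)) :
    pairWeight Λ p ≤ 1 := by
  unfold pairWeight
  split_ifs <;> norm_num

theorem hasSum_energy (hJ : 0 ≤ J) (hα : (d : ℝ) < α) {ψ : ZMod q → ℝ}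
    (hψ : ∀ n, 0 ≤ ψ n ∧ ψ n ≤ 1) {Λ : Finset (Fin d → ℤ)} {σ : (Fin d → ℤ) → ZMod q}
    (hσ : σ ∈ configs Λ 0) :
    HasSum (fun p : (Fin d → ℤ) × (Fin d → ℤ) =>
      pairWeight Λ p * (coupling J α p.1 p.2 * ψ (σ p.1 - σ p.2)))
      (energy J α ψ Λ (fun _ => 0) σ) := by
  classical
  have hs : Summable fun p : (Fin d → ℤ) × (Fin d → ℤ) =>
      pairWeight Λ p * (coupling J α p.1 p.2 * ψ (σ p.1 - σ p.2)) := by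
    refine Summable.of_nonneg_of_le (fun p => ?_) (fun p => ?_)
      (hasSum_pair_of_fst_mem hJ hα Λ).summable
    · exact mul_nonneg (pairWeight_nonneg Λ p)
        (mul_nonneg (coupling_nonneg hJ _ _) (hψ _).1)
    · have h1 : coupling J α p.1 p.2 * ψ (σ p.1 - σ p.2) ≤ coupling J α p.1 p.2 :=
        mul_le_of_le_one_right (coupling_nonneg hJ _ _) (hψ _).2
      by_cases hp : p.1 ∈ Λ
      · rw [if_pos hp]
        exact (mul_le_of_le_one_left (mul_nonneg (coupling_nonneg hJ _ _) (hψ _).1)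
          (pairWeight_le_one Λ p)).trans h1
      · simp [pairWeight, hp]
  convert hs.hasSum using 1
  rw [hs.tsum_prod, tsum_eq_sum (s := Λ) fun x hx => by simp [pairWeight, hx]]
  unfold energy
  rw [Finset.mul_sum, ← Finset.sum_add_distrib]
  refine Finset.sum_congr rfl fun x hx => ?_
  rw [← (hs.prod_factor x).sum_add_tsum_subtype_compl Λ, Finset.mul_sum]
  congr 1
  · refine Finset.sum_congr rfl fun y hy => ?_
    simp [pairWeight, hx, hy]
  · refine tsum_congr fun y => ?_
    simp [pairWeight, hx, y.2, hσ y y.2]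

/-- A symmetric lower bound `K` for the change of the pair interaction gives the lower bound
`½ ∑ K` for the change of the energy, although `ψ` itself need not be symmetric. -/
theorem half_tsum_le_energy_sub (hJ : 0 ≤ J) (hα : (d : ℝ) < α) {ψ : ZMod q → ℝ}
    (hψ : ∀ n, 0 ≤ ψ n ∧ ψ n ≤ 1) {Λ : Finset (Fin d → ℤ)} {σ τ : (Fin d → ℤ) → ZMod q}
    (hσ : σ ∈ configs Λ 0) (hτ : τ ∈ configs Λ 0) {K : (Fin d → ℤ) × (Fin d → ℤ) → ℝ}
    (hK : Summable K) (hsymm : ∀ p, K p.swap = K p)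
    (hle : ∀ p, K p ≤ coupling J α p.1 p.2 * (ψ (σ p.1 - σ p.2) - ψ (τ p.1 - τ p.2))) :
    (1 / 2) * ∑' p, K p ≤
      energy J α ψ Λ (fun _ => 0) σ - energy J α ψ Λ (fun _ => 0) τ := by
  have hcK : Summable fun p => pairWeight Λ p * K p := by
    refine Summable.of_norm_bounded hK.norm fun p => ?_
    rw [norm_mul, Real.norm_of_nonneg (pairWeight_nonneg Λ p)]
    exact mul_le_of_le_one_left (norm_nonneg _) (pairWeight_le_one Λ p)
  have h1 : ∑' p, pairWeight Λ p * K p ≤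
      energy J α ψ Λ (fun _ => 0) σ - energy J α ψ Λ (fun _ => 0) τ := by
    refine hasSum_le (fun p => ?_) hcK.hasSum
      ((hasSum_energy hJ hα hψ hσ).sub (hasSum_energy hJ hα hψ hτ))
    rw [← mul_sub, ← mul_sub]
    exact mul_le_mul_of_nonneg_left (hle p) (pairWeight_nonneg Λ p)
  have hsw := (Equiv.prodComm (Fin d → ℤ) (Fin d → ℤ)).hasSum_iff.2 hcK.hasSum
  have h2 : ∑' p, K p ≤ ∑' p, pairWeight Λ p * K p + ∑' p, pairWeight Λ p * K p := by
    refine hasSum_le (fun p => ?_) hK.hasSum (hcK.hasSum.add hsw)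
    simp only [Function.comp, Equiv.prodComm_apply, hsymm p, ← add_mul]
    by_cases hp1 : p.1 ∈ Λ <;> by_cases hp2 : p.2 ∈ Λ <;>
      simp only [pairWeight, hp1, hp2, Prod.fst_swap, Prod.snd_swap, if_true, if_false]
    · linarith
    · linarith
    · linarith
    · have := hle p
      rw [hσ _ hp1, hσ _ hp2, hτ _ hp1, hτ _ hp2] at this
      simpa using this
  linarith

end Energy

/-! ### The influence of the other contours -/

section Influence

variable {d q : ℕ} {J α : ℝ}

/-- The volume of a finite set, as a finite set. -/
noncomputable def volFinset (C : Finset (Fin d → ℤ)) : Finset (Fin d → ℤ) :=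
  (vol_finite C.finite_toSet).toFinset

theorem mem_volFinset {C : Finset (Fin d → ℤ)} {x : Fin d → ℤ} :
    x ∈ volFinset C ↔ x ∈ vol (C : Set (Fin d → ℤ)) := by
  simp [volFinset]

theorem card_volFinset (C : Finset (Fin d → ℤ)) :
    (volFinset C).card = (vol (C : Set (Fin d → ℤ))).ncard := by
  rw [← Set.ncard_coe_finset, volFinset, Set.Finite.coe_toFinset]

theorem exists_near_of_mem_volFinset (hd : 0 < d) {C : Finset (Fin d → ℤ)} {y : Fin d → ℤ}
    (hy : y ∈ volFinset C) : ∃ w ∈ C, l1dist y w ≤ (volFinset C).card := by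
  rw [card_volFinset]
  exact exists_mem_near_of_mem_vol hd C.finite_toSet (mem_volFinset.1 hy)

/-- If `e` at each site of `B` is dominated by `e` on a segment of `K + 1` sites starting there,
and no ball of radius `K` contains more than `n` sites of `B`, then the sum over `B` is at most a
fraction `n / (K + 1)` of the total sum. -/
theorem sum_le_of_spread (i : Fin d) {e : (Fin d → ℤ) → ℝ} (he : ∀ y, 0 ≤ e y)
    (hs : Summable e) {B : Finset (Fin d → ℤ)} {K n : ℕ} {c : ℝ} (hc : 0 ≤ c)
    (hspread : ∀ y ∈ B, ∀ k ≤ K, e y ≤ c * e (y + (k : ℤ) • unitVec i))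
    (hmult : ∀ z, (B.filter fun y => l1dist y z ≤ K).card ≤ n) :
    ((K : ℝ) + 1) * ∑ y ∈ B, e y ≤ c * (n * ∑' z, e z) := by
  classical
  let g : (Fin d → ℤ) × ℕ → (Fin d → ℤ) := fun p => p.1 + (p.2 : ℤ) • unitVec i
  set s := B ×ˢ Finset.range (K + 1)
  have hcard : ∀ z, (s.filter fun p => g p = z).card ≤ n := by
    intro z
    refine le_trans (Finset.card_le_card_of_injOn Prod.fst ?_ ?_) (hmult z)
    · rintro ⟨y, k⟩ hp
      simp only [s, g, Finset.coe_filter, Finset.mem_product, Finset.mem_range,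
        Set.mem_ofPred_eq] at hp
      simp only [Finset.coe_filter, Set.mem_ofPred_eq]
      refine ⟨hp.1.1, ?_⟩
      rw [← hp.2, l1dist_add_smul_unitVec]
      omega
    · rintro ⟨y, k⟩ hp ⟨y', k'⟩ hp' hyy
      simp only [Finset.coe_filter, Set.mem_ofPred_eq, g] at hp hp' hyy
      subst hyy
      rw [add_smul_unitVec_injective y i (hp.2.trans hp'.2.symm)]
  calc ((K : ℝ) + 1) * ∑ y ∈ B, e y = ∑ p ∈ s, e p.1 := by
        rw [Finset.sum_product]
        simp [Finset.mul_sum]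
    _ ≤ ∑ p ∈ s, c * e (g p) := by
        refine Finset.sum_le_sum fun p hp => ?_
        simp only [s, Finset.mem_product, Finset.mem_range] at hp
        exact hspread p.1 hp.1 p.2 (by omega)
    _ = c * ∑ z ∈ s.image g, (s.filter fun p => g p = z).card • e z := by
        rw [← Finset.mul_sum, Finset.sum_comp e g]
    _ ≤ c * ∑ z ∈ s.image g, (n : ℝ) * e z := by
        refine mul_le_mul_of_nonneg_left (Finset.sum_le_sum fun z _ => ?_) hc
        rw [nsmul_eq_mul]
        exact mul_le_mul_of_nonneg_right (by exact_mod_cast hcard z) (he z)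
    _ ≤ c * (n * ∑' z, e z) := by
        rw [← Finset.mul_sum]
        exact mul_le_mul_of_nonneg_left (mul_le_mul_of_nonneg_left
          (hs.sum_le_tsum _ fun z _ => he z) (Nat.cast_nonneg n)) hc

theorem cut_le_of_near {β : Type*} [DecidableEq β] {h : (Fin d → ℤ) → β} (hJ : 0 ≤ J)
    (hα : 0 ≤ α) {x y z : Fin d → ℤ} {K : ℕ} (hyz : l1dist y z ≤ K) (hh : h z = h y)
    (hfar : h x ≠ h y → K ≤ l1dist x y) : cut J α h (x, y) ≤ 2 ^ α * cut J α h (x, z) := by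
  by_cases hxy : h x = h y
  · have h0 : cut J α h (x, y) = 0 := if_pos hxy
    rw [h0]
    exact mul_nonneg (by positivity) (cut_nonneg hJ _)
  have hxz : h x ≠ h z := hh ▸ hxy
  have hne : x ≠ y := fun h' => hxy (h' ▸ rfl)
  have hne' : x ≠ z := fun h' => hxz (h' ▸ rfl)
  simp only [cut, hxy, hxz, if_false, coupling, hne, hne']
  have h1 : (l1dist x z : ℝ) ≤ 2 * l1dist x y := by
    have := l1dist_triangle x y z
    have := hfar hxy
    exact_mod_cast (by omega : l1dist x z ≤ 2 * l1dist x y)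
  have h2 : (0 : ℝ) < l1dist x z := by
    exact_mod_cast Nat.pos_of_ne_zero fun h0 => hne' (l1dist_eq_zero.1 h0)
  have h3 : (0 : ℝ) < l1dist x y := by linarith
  calc J / (l1dist x y : ℝ) ^ α = 2 ^ α * (J / (2 * l1dist x y : ℝ) ^ α) := by
        rw [Real.mul_rpow (by norm_num) h3.le]
        have : (0 : ℝ) < 2 ^ α := by positivity
        field_simp
    _ ≤ _ := by gcongr

theorem coupling_le_rpow_mul (hJ : 0 ≤ J) {δ R : ℝ} (hδ : 0 ≤ δ) (hR : 0 < R)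
    {x y : Fin d → ℤ} (hxy : R ≤ l1dist x y) :
    coupling J α x y ≤ R ^ (-δ) * coupling J (α - δ) x y := by
  unfold coupling
  split_ifs with h
  · simp
  have hD : (0 : ℝ) < l1dist x y := hR.trans_le hxy
  rw [Real.rpow_neg hR.le, Real.rpow_sub hD]
  have h1 : R ^ δ ≤ (l1dist x y : ℝ) ^ δ := Real.rpow_le_rpow hR.le hxy hδ
  have h2 : 0 < R ^ δ := by positivity
  have h3 : (0 : ℝ) < (l1dist x y : ℝ) ^ α := by positivity
  have h4 : (0 : ℝ) < (l1dist x y : ℝ) ^ δ := by positivity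
  rw [div_div_eq_mul_div, ← mul_div_assoc, inv_mul_eq_div]
  refine div_le_div_of_nonneg_right ?_ h3.le
  rw [le_div_iff₀ h2]
  gcongr

variable {σ h : (Fin d → ℤ) → ZMod q} {parts : Finset (Finset (Fin d → ℤ))}
  {S : Finset (Fin d → ℤ)}

open Classical in
/-- The sites in the volumes of those parts other than `S` whose volume has a size that
satisfies `Q`. -/
noncomputable def otherVolumes (parts : Finset (Finset (Fin d → ℤ))) (S : Finset (Fin d → ℤ))
    (Q : ℕ → Prop) : Finset (Fin d → ℤ) :=
  (parts.filter fun C => C ≠ S ∧ Q (volFinset C).card).biUnion volFinset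

theorem mem_otherVolumes {Q : ℕ → Prop} {y : Fin d → ℤ} :
    y ∈ otherVolumes parts S Q ↔
      ∃ C ∈ parts, C ≠ S ∧ Q (volFinset C).card ∧ y ∈ volFinset C := by
  classical
  simp only [otherVolumes, Finset.mem_biUnion, Finset.mem_filter]
  tauto

/-- The contours of volume `n ≤ |V(S)|` interact little with the disagreement set of the phase
function: that function is constant on a ball of radius of order `n³` around each of their sites,
and only `n` of these sites share such a ball. -/
theorem sum_cut_le_of_card_eq (hd : 0 < d) (hJ : 0 ≤ J) (hα : (d : ℝ) < α) {L : ℕ} (hL : 1 ≤ L)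
    (hh : IsPhase σ (S : Set (Fin d → ℤ)) h) (hS : S ∈ parts)
    (hsep : ∀ B ∈ parts, ∀ C ∈ parts, B ≠ C → ∀ x ∈ B, ∀ y ∈ C,
      4 * L * (min (volFinset B).card (volFinset C).card) ^ 3 < l1dist x y)
    {n : ℕ} (hn : 1 ≤ n) (hnS : n ≤ (volFinset S).card) {x : Fin d → ℤ}
    (hs : Summable fun y => cut J α h (x, y)) :
    ∑ y ∈ otherVolumes parts S (· = n), cut J α h (x, y) ≤
      2 ^ α / L * (1 / (n : ℝ) ^ 2) * ∑' y, cut J α h (x, y) := by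
  have hα0 : 0 ≤ α := (Nat.cast_nonneg d).trans hα.le
  have hnK : n ≤ L * n ^ 3 :=
    (Nat.le_self_pow (by norm_num) n).trans (Nat.le_mul_of_pos_left _ hL)
  have hsep' : ∀ B ∈ parts, ∀ C ∈ parts, B ≠ C → (volFinset B).card = n →
      n ≤ (volFinset C).card → ∀ x ∈ B, ∀ y ∈ C, 4 * (L * n ^ 3) < l1dist x y := by
    intro B hB C hC hBC h1 h2 x hx y hy
    have := hsep B hB C hC hBC x hx y hy
    rw [h1, min_eq_left h2] at this
    linarith
  have hball : ∀ y ∈ otherVolumes parts S (· = n), ∀ s ∈ S, 3 * (L * n ^ 3) < l1dist s y := by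
    intro y hy s hs
    obtain ⟨C, hC, hCS, hCn, hyC⟩ := mem_otherVolumes.1 hy
    obtain ⟨w, hw, hwd⟩ := exists_near_of_mem_volFinset hd hyC
    have h1 := hsep' C hC S hS hCS hCn hnS w hw s hs
    have h2 := l1dist_triangle w y s
    rw [l1dist_comm w y, l1dist_comm y s] at h2
    omega
  have key := sum_le_of_spread (⟨0, hd⟩ : Fin d) (e := fun y => cut J α h (x, y))
    (B := otherVolumes parts S (· = n)) (K := L * n ^ 3) (n := n) (c := 2 ^ α)
    (fun y => cut_nonneg hJ _) hs (by positivity) (by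
      intro y hy k hk
      have hb := hball y hy
      refine cut_le_of_near hJ hα0 (K := L * n ^ 3) ?_ ?_ ?_
      · rw [l1dist_add_smul_unitVec]; simpa using hk
      · refine hh.eq_of_ball (R := 3 * (L * n ^ 3)) (by exact_mod_cast hb) ?_
        rw [l1dist_comm, l1dist_add_smul_unitVec, Int.natAbs_natCast]
        omega
      · intro hne
        by_contra hlt
        exact hne (hh.eq_of_ball (R := 3 * (L * n ^ 3)) (by exact_mod_cast hb) (by omega)))
    (by
      intro z
      rcases Finset.eq_empty_or_nonempty
        ((otherVolumes parts S (· = n)).filter fun y => l1dist y z ≤ L * n ^ 3) with h0 | ⟨y₀, h0⟩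
      · simp [h0]
      rw [Finset.mem_filter] at h0
      obtain ⟨C₀, hC₀, hC₀S, hC₀n, hy₀⟩ := mem_otherVolumes.1 h0.1
      refine (Finset.card_le_card (t := volFinset C₀) fun y hy => ?_).trans hC₀n.le
      rw [Finset.mem_filter] at hy
      obtain ⟨C, hC, hCS, hCn, hyC⟩ := mem_otherVolumes.1 hy.1
      obtain ⟨w, hw, hwd⟩ := exists_near_of_mem_volFinset hd hyC
      obtain ⟨w₀, hw₀, hwd₀⟩ := exists_near_of_mem_volFinset hd hy₀
      suffices hCC : C = C₀ from hCC ▸ hyC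
      by_contra hne
      have h1 := hsep' C hC C₀ hC₀ hne hCn hC₀n.ge w hw w₀ hw₀
      have h2 := l1dist_triangle w y w₀
      have h3 := l1dist_triangle y z w₀
      have h4 := l1dist_triangle z y₀ w₀
      rw [l1dist_comm w y] at h2
      rw [l1dist_comm z y₀] at h4
      have h5 := h0.2
      have h6 := hy.2
      omega)
  have hT : 0 ≤ ∑' y, cut J α h (x, y) := tsum_nonneg fun y => cut_nonneg hJ _
  have hn0 : (0 : ℝ) < n := by exact_mod_cast hn
  have hL0 : (0 : ℝ) < L := by exact_mod_cast hL
  have hsum : 0 ≤ ∑ y ∈ otherVolumes parts S (· = n), cut J α h (x, y) :=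
    Finset.sum_nonneg fun y _ => cut_nonneg hJ _
  have hpos : (0 : ℝ) < L * (n : ℝ) ^ 3 := by positivity
  calc _ ≤ 2 ^ α * (n * ∑' y, cut J α h (x, y)) / (L * (n : ℝ) ^ 3) := by
        rw [le_div_iff₀ hpos]
        push_cast at key
        nlinarith
    _ = _ := by field_simp

theorem sum_cut_le_of_card_le (hd : 0 < d) (hJ : 0 ≤ J) (hα : (d : ℝ) < α) {L : ℕ} (hL : 1 ≤ L)
    (hh : IsPhase σ (S : Set (Fin d → ℤ)) h) (hS : S ∈ parts)
    (hsep : ∀ B ∈ parts, ∀ C ∈ parts, B ≠ C → ∀ x ∈ B, ∀ y ∈ C,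
      4 * L * (min (volFinset B).card (volFinset C).card) ^ 3 < l1dist x y)
    {x : Fin d → ℤ} (hs : Summable fun y => cut J α h (x, y)) :
    ∑ y ∈ otherVolumes parts S (· ≤ (volFinset S).card), cut J α h (x, y) ≤
      2 ^ α / L * (∑' n : ℕ, 1 / (n : ℝ) ^ 2) * ∑' y, cut J α h (x, y) := by
  classical
  set N := (volFinset S).card
  have hT : 0 ≤ ∑' y, cut J α h (x, y) := tsum_nonneg fun y => cut_nonneg hJ _
  calc ∑ y ∈ otherVolumes parts S (· ≤ N), cut J α h (x, y)
      ≤ ∑ y ∈ otherVolumes parts S (· ≤ N), ∑ n ∈ Finset.Icc 1 N,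
          if y ∈ otherVolumes parts S (· = n) then cut J α h (x, y) else 0 := by
        refine Finset.sum_le_sum fun y hy => ?_
        obtain ⟨C, hC, hCS, hCN, hyC⟩ := mem_otherVolumes.1 hy
        have h1 : (volFinset C).card ∈ Finset.Icc 1 N :=
          Finset.mem_Icc.2 ⟨Finset.card_pos.2 ⟨y, hyC⟩, hCN⟩
        have h2 : y ∈ otherVolumes parts S (· = (volFinset C).card) :=
          mem_otherVolumes.2 ⟨C, hC, hCS, rfl, hyC⟩
        refine le_trans (le_of_eq ?_) (Finset.single_le_sum (f := fun n =>
          if y ∈ otherVolumes parts S (· = n) then cut J α h (x, y) else 0)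
          (fun n _ => ?_) h1)
        · simp only [if_pos h2]
        · split_ifs
          · exact cut_nonneg hJ _
          · exact le_rfl
    _ = ∑ n ∈ Finset.Icc 1 N, ∑ y ∈ otherVolumes parts S (· ≤ N),
          if y ∈ otherVolumes parts S (· = n) then cut J α h (x, y) else 0 := Finset.sum_comm
    _ ≤ ∑ n ∈ Finset.Icc 1 N, ∑ y ∈ otherVolumes parts S (· = n), cut J α h (x, y) := by
        refine Finset.sum_le_sum fun n _ => ?_
        rw [← Finset.sum_filter]
        refine Finset.sum_le_sum_of_subset_of_nonneg (fun y hy => (Finset.mem_filter.1 hy).2)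
          fun y _ _ => cut_nonneg hJ _
    _ ≤ ∑ n ∈ Finset.Icc 1 N, 2 ^ α / L * (1 / (n : ℝ) ^ 2) * ∑' y, cut J α h (x, y) := by
        refine Finset.sum_le_sum fun n hn => ?_
        rw [Finset.mem_Icc] at hn
        exact sum_cut_le_of_card_eq hd hJ hα hL hh hS hsep hn.1 hn.2 hs
    _ ≤ _ := by
        rw [← Finset.sum_mul, ← Finset.mul_sum]
        refine mul_le_mul_of_nonneg_right (mul_le_mul_of_nonneg_left ?_ (by positivity)) hT
        exact (Real.summable_one_div_nat_pow.2 (by norm_num)).sum_le_tsum _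
          fun n _ => by positivity

open Classical in
/-- The total influence of the contours that are not larger than `S`. -/
theorem tsum_cut_card_le (hd : 0 < d) (hJ : 0 ≤ J) (hα : (d : ℝ) < α) {L : ℕ} (hL : 1 ≤ L)
    (hh : IsPhase σ (S : Set (Fin d → ℤ)) h) (hS : S ∈ parts)
    (hsep : ∀ B ∈ parts, ∀ C ∈ parts, B ≠ C → ∀ x ∈ B, ∀ y ∈ C,
      4 * L * (min (volFinset B).card (volFinset C).card) ^ 3 < l1dist x y)
    (hs : Summable (cut J α h)) :
    (∑' p, if p.2 ∈ otherVolumes parts S (· ≤ (volFinset S).card) then cut J α h p else 0) ≤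
      2 ^ α / L * (∑' n : ℕ, 1 / (n : ℝ) ^ 2) * ∑' p, cut J α h p := by
  have hs1 : Summable fun p =>
      if p.2 ∈ otherVolumes parts S (· ≤ (volFinset S).card) then cut J α h p else 0 := by
    refine Summable.of_nonneg_of_le (fun p => ?_) (fun p => ?_) hs <;> split_ifs
    · exact cut_nonneg hJ p
    · exact le_rfl
    · exact le_rfl
    · exact cut_nonneg hJ p
  rw [hs1.tsum_prod, hs.tsum_prod, ← tsum_mul_left]
  refine Summable.tsum_le_tsum (fun x => ?_) hs1.prod (hs.prod.mul_left _)
  rw [tsum_eq_sum (s := otherVolumes parts S (· ≤ (volFinset S).card))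
    fun y hy => by simp only [hy, if_false]]
  refine le_trans (le_of_eq (Finset.sum_congr rfl fun y hy => by simp only [hy, if_true]))
    (sum_cut_le_of_card_le hd hJ hα hL hh hS hsep (hs.prod_factor x))

open Classical in
/-- The total influence of the contours that are larger than `S`. They are at distance more than
`R` from `S`; if `S` does not meet their volumes, then neither does `vol S`, so that only the pairs
between `vol S` and sites at distance at least `R / 2` matter. -/
theorem tsum_cut_card_gt (hd : 0 < d) (hJ : 0 ≤ J) {δ : ℝ} (hδ : 0 ≤ δ)
    (hα : (d : ℝ) < α - δ) {R : ℝ} (hR : 0 < R)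
    (hNR : 2 * ((volFinset S).card : ℝ) ≤ R)
    (hh : IsPhase σ (S : Set (Fin d → ℤ)) h)
    (hext : ∀ C ∈ parts, C ≠ S → ∀ s ∈ S, s ∉ volFinset C)
    (hsep : ∀ C ∈ parts, C ≠ S → (volFinset S).card < (volFinset C).card →
      ∀ x ∈ C, ∀ s ∈ S, R < l1dist x s) :
    (∑' p, if p.2 ∈ otherVolumes parts S ((volFinset S).card < ·) then cut J α h p else 0) ≤
      (R / 2) ^ (-δ) * ((volFinset S).card * ∑' y : Fin d → ℤ, coupling J (α - δ) 0 y) := by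
  have hb := (hasSum_pair_of_fst_mem hJ hα (volFinset S)).mul_left ((R / 2) ^ (-δ))
  have hnn : ∀ p : (Fin d → ℤ) × (Fin d → ℤ), 0 ≤ (R / 2) ^ (-δ) *
      (if p.1 ∈ volFinset S then coupling J (α - δ) p.1 p.2 else 0) := fun p => by
    refine mul_nonneg (by positivity) ?_
    split_ifs
    · exact coupling_nonneg hJ _ _
    · exact le_rfl
  have hle : ∀ p : (Fin d → ℤ) × (Fin d → ℤ),
      (if p.2 ∈ otherVolumes parts S ((volFinset S).card < ·) then cut J α h p else 0) ≤
      (R / 2) ^ (-δ) * (if p.1 ∈ volFinset S then coupling J (α - δ) p.1 p.2 else 0) := by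
    rintro ⟨x, y⟩
    dsimp only
    split_ifs with hy hx hx
    · obtain ⟨C, hC, hCS, hCN, hyC⟩ := mem_otherVolumes.1 hy
      refine (cut_le hJ _).trans (coupling_le_rpow_mul hJ hδ (by positivity) ?_)
      have hys : ∀ s ∈ S, R < l1dist y s := fun s hs => by
        obtain ⟨w, hw, hwd⟩ := exists_mem_geodesic (mem_volFinset.1 hyC)
          (fun h' => hext C hC hCS s hs (mem_volFinset.2 h'))
        refine (hsep C hC hCS hCN w hw s hs).trans_le ?_
        exact_mod_cast (by omega : l1dist w s ≤ l1dist y s)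
      obtain ⟨s, hs, hsd⟩ := exists_near_of_mem_volFinset hd hx
      have h1 := hys s hs
      have h2 := l1dist_triangle y x s
      rw [l1dist_comm y x] at h2
      have h3 : (l1dist y s : ℝ) ≤ l1dist x y + (volFinset S).card := by
        exact_mod_cast (by omega : l1dist y s ≤ l1dist x y + (volFinset S).card)
      change R / 2 ≤ (l1dist x y : ℝ)
      linarith
    · obtain ⟨C, hC, hCS, hCN, hyC⟩ := mem_otherVolumes.1 hy
      have hyS : y ∉ volFinset S := fun hyS => by
        obtain ⟨s, hs, hsd⟩ := exists_near_of_mem_volFinset hd hyS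
        obtain ⟨w, hw, hwd⟩ := exists_mem_geodesic (mem_volFinset.1 hyC)
          (fun h' => hext C hC hCS s hs (mem_volFinset.2 h'))
        have h1 := hsep C hC hCS hCN w hw s hs
        have h2 : (l1dist w s : ℝ) ≤ (volFinset S).card := by
          exact_mod_cast (by omega : l1dist w s ≤ (volFinset S).card)
        have h3 : (0 : ℝ) ≤ (volFinset S).card := Nat.cast_nonneg _
        linarith
      rw [mem_volFinset] at hx hyS
      simp [cut, hh.off_vol x hx, hh.off_vol y hyS]
    · simpa [hx] using hnn (x, y)
    · simp
  refine hasSum_le hle (Summable.hasSum ?_) hb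
  refine Summable.of_nonneg_of_le (fun p => ?_) hle hb.summable
  split_ifs
  · exact cut_nonneg hJ p
  · exact le_rfl

end Influence

/-! ### Surface energies against the cut of the phase function -/

section Surface

variable {d q : ℕ} {J α : ℝ} {σ h : (Fin d → ℤ) → ZMod q} {S : Finset (Fin d → ℤ)}

/-- Each incorrect site of `S` contributes an edge on which the phase function disagrees. -/
theorem card_mul_le_tsum_cut (hJ : 0 ≤ J) (hh : IsPhase σ (S : Set (Fin d → ℤ)) h)
    (hS : ∀ x ∈ S, x ∈ boundary σ) (hs : Summable (cut J α h)) :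
    (S.card : ℝ) * J ≤ ∑' p, cut J α h p := by
  classical
  have hex : ∀ x, ∃ y, x ∈ S → cut J α h (x, y) = J := by
    intro x
    by_cases hx : x ∈ S
    · obtain ⟨y, hxy, hne⟩ := exists_ne_of_mem_boundary (hS x hx)
      refine ⟨y, fun _ => ?_⟩
      have h1 := hh.touch x y hxy (Or.inl (by exact_mod_cast hx))
      have h2 : h x ≠ h y := fun h2 => by
        rw [h2, sub_self] at h1
        exact hne (sub_eq_zero.1 h1.symm)
      simp [cut, h2, coupling_of_l1dist_eq_one hxy]
    · exact ⟨x, fun h' => absurd h' hx⟩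
  choose y hy using hex
  calc (S.card : ℝ) * J = ∑ x ∈ S, cut J α h (x, y x) := by
        rw [Finset.sum_congr rfl hy]; simp
    _ = ∑ p ∈ S.image fun x => (x, y x), cut J α h p :=
        (Finset.sum_image fun a _ b _ hab => congrArg Prod.fst hab).symm
    _ ≤ _ := hs.sum_le_tsum _ fun p _ => cut_nonneg hJ p

theorem surfaceEnergy_le_card_mul (hJ : 0 ≤ J) (hα : (d : ℝ) < α) (S : Finset (Fin d → ℤ)) :
    surfaceEnergy J α (S : Set (Fin d → ℤ)) ≤
      S.card * ∑' y : Fin d → ℤ, coupling J α 0 y := by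
  classical
  have hb := hasSum_pair_of_fst_mem hJ hα S
  obtain ⟨A, hA⟩ : ∃ A : Set (Fin d → ℤ), A = S := ⟨_, rfl⟩
  have hle : ∀ p : (Fin d → ℤ) × (Fin d → ℤ),
      (if p.1 ∈ A ∧ p.2 ∉ A then coupling J α p.1 p.2 else 0) ≤
      if p.1 ∈ S then coupling J α p.1 p.2 else 0 := fun p => by
    have := coupling_nonneg (α := α) hJ p.1 p.2
    by_cases h1 : p.1 ∈ S <;> by_cases h2 : p.2 ∈ S <;> simp [hA, h1, h2, this]
  rw [← hA, surfaceEnergy_eq]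
  refine hasSum_le hle (Summable.hasSum ?_) hb
  refine Summable.of_nonneg_of_le (fun p => ?_) hle hb.summable
  split_ifs
  · exact coupling_nonneg hJ _ _
  · exact le_rfl

/-- If disjoint regions are left only through `S` or through pairs on which `h` disagrees, their
surface energies add up to at most the coupling of `S` to all sites plus the cut of `h`. -/
theorem sum_surfaceEnergy_le (hJ : 0 ≤ J) (hα : (d : ℝ) < α) (S : Finset (Fin d → ℤ))
    (hs : Summable (cut J α h)) {ι : Type*} (t : Finset ι) (I : ι → Set (Fin d → ℤ))
    (hdisj : ∀ x, ∀ n ∈ t, ∀ n' ∈ t, x ∈ I n → x ∈ I n' → n = n')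
    (hleave : ∀ n ∈ t, ∀ x ∈ I n, ∀ y ∉ I n, y ∉ S → h x ≠ h y) :
    ∑ n ∈ t, surfaceEnergy J α (I n) ≤
      S.card * ∑' y : Fin d → ℤ, coupling J α 0 y + ∑' p, cut J α h p := by
  classical
  have hb := (hasSum_pair_of_snd_mem hJ hα S).add hs.hasSum
  have hg : ∀ p : (Fin d → ℤ) × (Fin d → ℤ),
      0 ≤ (if p.2 ∈ S then coupling J α p.1 p.2 else 0) + cut J α h p := fun p => by
    refine add_nonneg ?_ (cut_nonneg hJ p)
    split_ifs
    · exact coupling_nonneg hJ _ _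
    · exact le_rfl
  have hle : ∀ n ∈ t, ∀ p : (Fin d → ℤ) × (Fin d → ℤ),
      (if p.1 ∈ I n ∧ p.2 ∉ I n then coupling J α p.1 p.2 else 0) ≤
      (if p.2 ∈ S then coupling J α p.1 p.2 else 0) + cut J α h p := by
    intro n hn p
    split_ifs with h1 h2 h2
    · exact le_add_of_nonneg_right (cut_nonneg hJ p)
    · simp [cut, hleave n hn _ h1.1 _ h1.2 h2]
    · simpa [h2] using hg p
    · simpa [h2] using hg p
  have hsum : ∀ n ∈ t, Summable fun p : (Fin d → ℤ) × (Fin d → ℤ) =>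
      if p.1 ∈ I n ∧ p.2 ∉ I n then coupling J α p.1 p.2 else 0 := fun n hn => by
    refine Summable.of_nonneg_of_le (fun p => ?_) (hle n hn) hb.summable
    split_ifs
    · exact coupling_nonneg hJ _ _
    · exact le_rfl
  rw [Finset.sum_congr rfl fun n _ => surfaceEnergy_eq (I n), ← Summable.tsum_finsetSum hsum]
  refine hasSum_le (fun p => ?_) (summable_sum hsum).hasSum hb
  by_cases hex : ∃ n ∈ t, p.1 ∈ I n
  · obtain ⟨n, hn, hpn⟩ := hex
    rw [Finset.sum_eq_single_of_mem n hn fun n' hn' hne =>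
      if_neg fun hp => hne (hdisj p.1 n' hn' n hn hp.1 hpn)]
    exact hle n hn p
  · push Not at hex
    rw [Finset.sum_eq_zero fun n hn => if_neg fun hp => hex n hn hp.1]
    exact hg p

end Surface

/-! ### The energy gained by erasing a contour -/

/-- The pointwise form of the energy bound: the disagreement of the phase function is a gain of at
least `m`, except for pairs with a site in another volume, where at most `1` is lost. -/
theorem cut_le_coupling_mul {d q : ℕ} {J α m : ℝ} (hJ : 0 ≤ J) {ψ : ZMod q → ℝ}
    (hψ0 : ψ 0 = 0) (hψ : ∀ n, 0 ≤ ψ n ∧ ψ n ≤ 1) (hψm : ∀ n, n ≠ 0 → m ≤ ψ n) (hm : 0 ≤ m)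
    {σ τ h : (Fin d → ℤ) → ZMod q} (hτ : ∀ x, τ x = σ x - h x)
    {e : (Fin d → ℤ) × (Fin d → ℤ) → ℝ} (he0 : ∀ p, 0 ≤ e p) (hele : ∀ p, h p.1 = h p.2 → e p = 0)
    (he : ∀ p, σ p.2 ≠ h p.2 → cut J α h p ≤ e p) (p : (Fin d → ℤ) × (Fin d → ℤ)) :
    m * cut J α h p - (1 + m) * (e p + e p.swap) ≤
      coupling J α p.1 p.2 * (ψ (σ p.1 - σ p.2) - ψ (τ p.1 - τ p.2)) := by
  have hc := coupling_nonneg (α := α) hJ p.1 p.2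
  by_cases hp : h p.1 = h p.2
  · have h1 : τ p.1 - τ p.2 = σ p.1 - σ p.2 := by rw [hτ, hτ, hp, sub_sub_sub_cancel_right]
    rw [hele p hp, hele p.swap (by simpa using hp.symm), h1]
    simp [cut, hp]
  have hcut : cut J α h p = coupling J α p.1 p.2 := if_neg hp
  by_cases hB : σ p.1 = h p.1 ∧ σ p.2 = h p.2
  · have h1 : τ p.1 - τ p.2 = 0 := by rw [hτ, hτ, hB.1, hB.2]; simp
    have h2 := hψm (σ p.1 - σ p.2) (by rw [hB.1, hB.2]; exact sub_ne_zero.2 hp)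
    rw [h1, hψ0, sub_zero, hcut]
    have h3 := he0 p
    have h4 := he0 p.swap
    have h5 : 0 ≤ (1 + m) * (e p + e p.swap) := by positivity
    have h6 := mul_le_mul_of_nonneg_left h2 hc
    linarith
  · have h1 : cut J α h p ≤ e p + e p.swap := by
      rw [not_and_or] at hB
      rcases hB with hB | hB
      · have := he p.swap (by simpa using hB)
        rw [cut_swap] at this
        linarith [he0 p]
      · linarith [he p hB, he0 p.swap]
    have h2 : -1 ≤ ψ (σ p.1 - σ p.2) - ψ (τ p.1 - τ p.2) := by
      linarith [(hψ (σ p.1 - σ p.2)).1, (hψ (τ p.1 - τ p.2)).2]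
    have h3 := mul_le_mul_of_nonneg_left h2 hc
    have h4 := mul_le_mul_of_nonneg_left h1 (by linarith : 0 ≤ 1 + m)
    rw [hcut] at h4 ⊢
    linarith

open Classical in
/-- The energy bound in terms of the cut of the phase function, for a separation constant `L` so
large that the other contours cost at most half of the gain. -/
theorem tsum_cut_le_energy_sub {d q : ℕ} (hd : 0 < d) {J α m : ℝ} (hJ : 0 < J)
    {δ : ℝ} (hδ : 0 ≤ δ) (hα : (d : ℝ) < α - δ) (hm : 0 < m) {ψ : ZMod q → ℝ}
    (hψ0 : ψ 0 = 0) (hψ : ∀ n, 0 ≤ ψ n ∧ ψ n ≤ 1) (hψm : ∀ n, n ≠ 0 → m ≤ ψ n)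
    {Λ : Finset (Fin d → ℤ)} {σ τ h : (Fin d → ℤ) → ZMod q} (hσ : σ ∈ configs Λ 0)
    (hτΛ : τ ∈ configs Λ 0) (hτ : ∀ x, τ x = σ x - h x)
    {parts : Finset (Finset (Fin d → ℤ))} {S : Finset (Fin d → ℤ)} (hS : S ∈ parts)
    (hS0 : S.Nonempty) (hSσ : ∀ x ∈ S, x ∈ boundary σ)
    (hh : IsPhase σ (S : Set (Fin d → ℤ)) h)
    (hoff : ∀ x, (∀ C ∈ parts, C ≠ S → x ∉ volFinset C) → σ x = h x)
    (hext : ∀ C ∈ parts, C ≠ S → ∀ s ∈ S, s ∉ volFinset C)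
    {L : ℕ} (hL : 1 ≤ L)
    (hsep : ∀ B ∈ parts, ∀ C ∈ parts, B ≠ C → ∀ x ∈ B, ∀ y ∈ C,
      4 * L * (min (volFinset B).card (volFinset C).card) ^ 3 < l1dist x y)
    {π : ℝ} (hπ : 1 ≤ π) (hπδ : 1 ≤ π * δ)
    (hsep' : ∀ C ∈ parts, C ≠ S → (volFinset S).card < (volFinset C).card →
      ∀ x ∈ C, ∀ s ∈ S, 4 * L * ((volFinset S).card : ℝ) ^ π < l1dist x s)
    (hLm : 2 * (1 + m) * (2 ^ α / L * (∑' n : ℕ, 1 / (n : ℝ) ^ 2) +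
      (2 * L : ℝ) ^ (-δ) * ((∑' y : Fin d → ℤ, coupling J (α - δ) 0 y) / J)) ≤ m / 2) :
    m / 4 * ∑' p, cut J α h p ≤
      energy J α ψ Λ (fun _ => 0) σ - energy J α ψ Λ (fun _ => 0) τ := by
  have hα' : (d : ℝ) < α := by linarith
  have hs : Summable (cut J α h) := summable_cut hJ.le hα' (b := 0) (volFinset S)
    fun x hx => hh.off_vol x fun h' => hx (mem_volFinset.2 h')
  set T := ∑' p, cut J α h p with hT
  set N := (volFinset S).card with hN
  set Θ := ∑' y : Fin d → ℤ, coupling J (α - δ) 0 y with hΘ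
  have hΘ0 : 0 ≤ Θ := tsum_nonneg fun y => coupling_nonneg hJ.le _ _
  have hJT : J ≤ T := by
    have h1 := card_mul_le_tsum_cut hJ.le hh hSσ hs
    have h2 : (1 : ℝ) ≤ S.card := by exact_mod_cast hS0.card_pos
    nlinarith
  have hN1 : (1 : ℝ) ≤ N := by
    obtain ⟨s, hs⟩ := hS0
    have : 0 < N := Finset.card_pos.2
      ⟨s, mem_volFinset.2 (subset_vol _ (by exact_mod_cast hs))⟩
    exact_mod_cast this
  have hL1 : (1 : ℝ) ≤ L := by exact_mod_cast hL
  let e₁ : (Fin d → ℤ) × (Fin d → ℤ) → ℝ := fun p =>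
    if p.2 ∈ otherVolumes parts S (· ≤ N) then cut J α h p else 0
  let e₂ : (Fin d → ℤ) × (Fin d → ℤ) → ℝ := fun p =>
    if p.2 ∈ otherVolumes parts S (N < ·) then cut J α h p else 0
  have e_nonneg : ∀ (Q : ℕ → Prop) p,
      0 ≤ if p.2 ∈ otherVolumes parts S Q then cut J α h p else 0 := fun Q p => by
    split_ifs
    · exact cut_nonneg hJ.le p
    · exact le_rfl
  have e_le : ∀ (Q : ℕ → Prop) p,
      (if p.2 ∈ otherVolumes parts S Q then cut J α h p else 0) ≤ cut J α h p := fun Q p => by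
    split_ifs
    · exact le_rfl
    · exact cut_nonneg hJ.le p
  have hs₁ : Summable e₁ := Summable.of_nonneg_of_le (e_nonneg _) (e_le _) hs
  have hs₂ : Summable e₂ := Summable.of_nonneg_of_le (e_nonneg _) (e_le _) hs
  have b₁ : ∑' p, e₁ p ≤ 2 ^ α / L * (∑' n : ℕ, 1 / (n : ℝ) ^ 2) * T :=
    tsum_cut_card_le hd hJ.le hα' hL hh hS hsep hs
  have b₂ : ∑' p, e₂ p ≤ (2 * L : ℝ) ^ (-δ) * (Θ / J) * T := by
    have hR : N ≤ (N : ℝ) ^ π := Real.self_le_rpow_of_one_le hN1 hπ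
    have h1 := tsum_cut_card_gt hd hJ.le hδ hα (R := 4 * L * (N : ℝ) ^ π) (by positivity)
      (by nlinarith) hh hext hsep'
    refine h1.trans ?_
    have h2 : (4 * L * (N : ℝ) ^ π / 2) ^ (-δ) = (2 * L : ℝ) ^ (-δ) * (N : ℝ) ^ (-(π * δ)) := by
      rw [show 4 * (L : ℝ) * (N : ℝ) ^ π / 2 = (2 * L) * (N : ℝ) ^ π by ring,
        Real.mul_rpow (by positivity) (by positivity), ← Real.rpow_mul (by positivity)]
      ring_nf
    have h3 : (N : ℝ) ^ (-(π * δ)) * N ≤ 1 := by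
      calc (N : ℝ) ^ (-(π * δ)) * N ≤ (N : ℝ) ^ (-1 : ℝ) * N :=
            mul_le_mul_of_nonneg_right
              (Real.rpow_le_rpow_of_exponent_le hN1 (by linarith)) (by positivity)
        _ = 1 := by rw [Real.rpow_neg_one, inv_mul_cancel₀ (by positivity)]
    have h4 : Θ ≤ Θ / J * T := by
      rw [div_mul_eq_mul_div, le_div_iff₀ hJ]
      exact mul_le_mul_of_nonneg_left hJT hΘ0
    have h5 : (0 : ℝ) ≤ (2 * L : ℝ) ^ (-δ) := by positivity
    rw [h2]
    calc _ = (2 * L : ℝ) ^ (-δ) * ((N : ℝ) ^ (-(π * δ)) * N) * Θ := by ring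
      _ ≤ (2 * L : ℝ) ^ (-δ) * 1 * Θ := by gcongr
      _ = (2 * L : ℝ) ^ (-δ) * Θ := by ring
      _ ≤ (2 * L : ℝ) ^ (-δ) * (Θ / J * T) := by gcongr
      _ = _ := by ring
  let e : (Fin d → ℤ) × (Fin d → ℤ) → ℝ := fun p => e₁ p + e₂ p
  have hse : HasSum e (∑' p, e₁ p + ∑' p, e₂ p) := hs₁.hasSum.add hs₂.hasSum
  have hsw := (Equiv.prodComm (Fin d → ℤ) (Fin d → ℤ)).hasSum_iff.2 hse
  have hK : HasSum (fun p => m * cut J α h p - (1 + m) * (e p + e p.swap))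
      (m * T - (1 + m) * (∑' p, e₁ p + ∑' p, e₂ p + (∑' p, e₁ p + ∑' p, e₂ p))) :=
    (hs.hasSum.mul_left m).sub ((hse.add hsw).mul_left (1 + m))
  have key := half_tsum_le_energy_sub hJ.le hα' hψ hσ hτΛ hK.summable
    (fun p => by
      simp only [Prod.swap_swap, cut_swap]
      ring)
    (cut_le_coupling_mul hJ.le hψ0 hψ hψm hm.le hτ (e := e)
      (fun p => add_nonneg (e_nonneg _ p) (e_nonneg _ p))
      (fun p hp => by simp [e, e₁, e₂, cut, hp])
      (fun p hp => by
        have hex : ∃ C ∈ parts, C ≠ S ∧ p.2 ∈ volFinset C := by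
          by_contra! hcon
          exact hp (hoff p.2 hcon)
        obtain ⟨C, hC, hCS, hpC⟩ := hex
        rcases le_or_gt (volFinset C).card N with hle | hgt
        · have : e₁ p = cut J α h p := if_pos (mem_otherVolumes.2 ⟨C, hC, hCS, hle, hpC⟩)
          change _ ≤ e₁ p + e₂ p
          rw [this]
          exact le_add_of_nonneg_right (e_nonneg _ p)
        · have : e₂ p = cut J α h p := if_pos (mem_otherVolumes.2 ⟨C, hC, hCS, hgt, hpC⟩)
          change _ ≤ e₁ p + e₂ p
          rw [this]
          exact le_add_of_nonneg_left (e_nonneg _ p)))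
  rw [hK.tsum_eq] at key
  refine le_trans ?_ key
  have h1 := mul_le_mul_of_nonneg_right hLm (hJ.le.trans hJT)
  have h2 := mul_le_mul_of_nonneg_left (add_le_add b₁ b₂) (by linarith : 0 ≤ 2 * (1 + m))
  nlinarith

/-- A constant from which on the influence of the other contours is small enough. -/
theorem exists_separation_constant {δ ε c₁ c₂ : ℝ} (hδ : 0 < δ) (hε : 0 < ε) :
    ∃ L : ℕ, 1 ≤ L ∧ c₁ / L + (2 * L : ℝ) ^ (-δ) * c₂ ≤ ε := by
  have h1 : Filter.Tendsto (fun L : ℕ => c₁ / (L : ℝ)) Filter.atTop (nhds 0) :=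
    tendsto_const_div_atTop_nhds_zero_nat c₁
  have h2 : Filter.Tendsto (fun L : ℕ => (2 * L : ℝ) ^ (-δ) * c₂) Filter.atTop (nhds (0 * c₂)) :=
    ((tendsto_rpow_neg_atTop hδ).comp
      (tendsto_natCast_atTop_atTop.const_mul_atTop (by norm_num : (0 : ℝ) < 2))).mul_const c₂
  have h3 := h1.add h2
  rw [zero_mul, add_zero] at h3
  obtain ⟨L, hL, hL1⟩ := ((h3.eventually_le_const hε).and (Filter.eventually_ge_atTop 1)).exists
  exact ⟨L, hL1, hL⟩

end LongRange

open LongRange in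
theorem proposition4p3 (d : ℕ) (hd : 2 ≤ d) (α : ℝ) (hα : (d : ℝ) < α) (J : ℝ) (hJ : 0 < J)
    (m : ℝ) (hm : 0 < m) :
    ∃ c₂ : ℝ, 0 < c₂ ∧ ∃ M₀ : ℝ, 0 < M₀ ∧ ∀ M : ℝ, M₀ ≤ M →
      ∀ (q : ℕ), 2 ≤ q → ∀ ψ : ZMod q → ℝ, ψ 0 = 0 → (∀ n, 0 ≤ ψ n ∧ ψ n ≤ 1) →
      IsLeast (ψ '' {n | n ≠ 0}) m →
      ∀ (Λ : Finset (Fin d → ℤ)), ∀ σ ∈ configs Λ (0 : ZMod q),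
      ∀ γ ∈ externalContours (contours M (3 * ((d : ℝ) + 1) / min (α - d) 1) σ),
        (((lattice d).induce ((Λ : Set (Fin d → ℤ))ᶜ)).Connected →
          γ.erase σ ∈ configs Λ (0 : ZMod q)) ∧
        (γ.erase σ ∈ configs Λ (0 : ZMod q) →
          c₂ * ((γ.sp.card : ℝ) + surfaceEnergy J α (γ.sp : Set (Fin d → ℤ)) +
              ∑ n ∈ Finset.Icc 1 (q - 1), surfaceEnergy J α (γ.interiorLabel (n : ZMod q)) +
              surfaceEnergy J α γ.interior') ≤
            energy J α ψ Λ (fun _ => 0) σ - energy J α ψ Λ (fun _ => 0) (γ.erase σ)) := by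
  classical
  have hd0 : 0 < d := by omega
  set δ : ℝ := (α - d) / 2 with hδ
  have hδ0 : 0 < δ := by rw [hδ]; linarith
  have hαδ : (d : ℝ) < α - δ := by rw [hδ]; linarith
  set Θ := ∑' y : Fin d → ℤ, coupling J α 0 y with hΘ
  have hΘ0 : 0 ≤ Θ := tsum_nonneg fun y => coupling_nonneg hJ.le _ _
  obtain ⟨L, hL, hLm⟩ := exists_separation_constant (δ := δ) (ε := m / 2 / (2 * (1 + m)))
    (c₁ := 2 ^ α * ∑' n : ℕ, 1 / (n : ℝ) ^ 2)
    (c₂ := (∑' y : Fin d → ℤ, coupling J (α - δ) 0 y) / J) hδ0 (by positivity)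
  have hL1 : (1 : ℝ) ≤ L := by exact_mod_cast hL
  rw [le_div_iff₀' (by positivity)] at hLm
  set κ : ℝ := (1 + 3 * Θ) / J + 2 with hκ
  have hκ0 : 0 < κ := by positivity
  refine ⟨m / 4 / κ, by positivity, 4 * L, by positivity, ?_⟩
  intro M hM q hq ψ hψ0 hψ hmin Λ σ hσ γ hγ
  have : NeZero q := ⟨by omega⟩
  have hψm : ∀ n, n ≠ 0 → m ≤ ψ n := fun n hn => hmin.2 ⟨n, hn, rfl⟩
  obtain ⟨⟨A, P, hA, hP, hSP, hspin⟩, hγext⟩ := hγ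
  set S := γ.sp with hS
  -- The exponent of the separation condition.
  have hmin0 : 0 < min (α - d) 1 := lt_min (by linarith) one_pos
  set π : ℝ := 3 / min (α - d) 1 with hπ
  have hπ3 : 3 ≤ π := by
    rw [hπ, le_div_iff₀ hmin0]
    linarith [min_le_right (α - d) 1]
  have hπδ : 1 ≤ π * δ := by
    rw [hπ, hδ, div_mul_eq_mul_div, le_div_iff₀ hmin0]
    linarith [min_le_left (α - d) 1]
  have hexp : 3 * ((d : ℝ) + 1) / min (α - d) 1 / ((d : ℝ) + 1) = π := by
    rw [hπ]; field_simp
  have hcard1 : ∀ B ∈ P.parts, 1 ≤ (volFinset B).card := fun B hB => by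
    obtain ⟨b, hb⟩ := P.nonempty_of_mem_parts hB
    exact Finset.card_pos.2 ⟨b, mem_volFinset.2 (subset_vol _ (by exact_mod_cast hb))⟩
  have hsepR : ∀ B ∈ P.parts, ∀ C ∈ P.parts, B ≠ C → ∀ x ∈ B, ∀ y ∈ C,
      4 * L * ((min (volFinset B).card (volFinset C).card : ℕ) : ℝ) ^ π < l1dist x y := by
    intro B hB C hC hBC x hx y hy
    have h1 := hP.1 B hB C hC hBC x hx y hy
    rw [hexp, ← card_volFinset, ← card_volFinset] at h1
    refine lt_of_le_of_lt ?_ h1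
    push_cast
    gcongr
  have hsep : ∀ B ∈ P.parts, ∀ C ∈ P.parts, B ≠ C → ∀ x ∈ B, ∀ y ∈ C,
      4 * L * (min (volFinset B).card (volFinset C).card) ^ 3 < l1dist x y := by
    intro B hB C hC hBC x hx y hy
    have h1 := hsepR B hB C hC hBC x hx y hy
    have h2 : (1 : ℝ) ≤ ((min (volFinset B).card (volFinset C).card : ℕ) : ℝ) := by
      exact_mod_cast le_min (hcard1 B hB) (hcard1 C hC)
    have h3 := Real.rpow_le_rpow_of_exponent_le h2 hπ3
    rw [show (3 : ℝ) = ((3 : ℕ) : ℝ) by norm_num, Real.rpow_natCast] at h3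
    have h4 : 4 * (L : ℝ) * ((min (volFinset B).card (volFinset C).card : ℕ) : ℝ) ^ 3 <
        l1dist x y := lt_of_le_of_lt (by gcongr) h1
    exact_mod_cast h4
  have hsep2 : ∀ B ∈ P.parts, ∀ C ∈ P.parts, B ≠ C → ∀ x ∈ B, ∀ y ∈ C, 2 < l1dist x y := by
    intro B hB C hC hBC x hx y hy
    have h1 := hsep B hB C hC hBC x hx y hy
    have h2 : 1 ≤ (min (volFinset B).card (volFinset C).card) ^ 3 :=
      Nat.one_le_pow _ _ (le_min (hcard1 B hB) (hcard1 C hC))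
    nlinarith
  have hsepB : ∀ B ∈ P.parts, ∀ x ∈ boundary σ, x ∉ (B : Set (Fin d → ℤ)) →
      ∀ s ∈ (B : Set (Fin d → ℤ)), 2 < l1dist x s := by
    intro B hB x hx hxB s hs
    rw [← hA] at hx
    obtain ⟨C, hC, hxC⟩ := P.exists_mem (Finset.mem_coe.1 hx)
    exact hsep2 C hC B hB (fun h' => hxB (by exact_mod_cast h' ▸ hxC)) x hxC s hs
  -- The phase functions of all the parts.
  have hphase : ∀ B : Finset (Fin d → ℤ), ∃ h, B ∈ P.parts → IsPhase σ (B : Set (Fin d → ℤ)) h := by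
    intro B
    by_cases hB : B ∈ P.parts
    · obtain ⟨h, hh⟩ := exists_isPhase hd B.finite_toSet (hsepB B hB)
      exact ⟨h, fun _ => hh⟩
    · exact ⟨0, fun h' => absurd h' hB⟩
  choose hf hhf using hphase
  set h := hf S
  have hh : IsPhase σ (S : Set (Fin d → ℤ)) h := hhf S hSP
  have hsum := eq_sum_phase hd hσ hA P hsep2 hhf
  have hoff : ∀ x, (∀ C ∈ P.parts, C ≠ S → x ∉ volFinset C) → σ x = h x := by
    intro x hx
    rw [hsum x]
    exact Finset.sum_eq_single_of_mem S hSP fun C hC hCS =>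
      (hhf C hC).off_vol x fun h' => hx C hC hCS (mem_volFinset.2 h')
  have hext : ∀ C ∈ P.parts, C ≠ S → ∀ s ∈ S, s ∉ volFinset C := by
    intro C hC hCS s hs hsC
    have h1 := hγext ⟨C, fun x => σ x⟩ ⟨A, P, hA, hP, hC, fun _ => rfl⟩
      (fun h' => hCS (congrArg Contour.sp h'))
    exact Set.disjoint_left.1 h1 (by exact_mod_cast hs) (mem_volFinset.1 hsC)
  have hσS : ∀ x ∈ γ.sp, σ x = h x := fun x hx =>
    hoff x fun C hC hCS => hext C hC hCS x hx
  have hτ := γ.erase_eq_sub hd hspin (hsepB S hSP) hh hσS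
  refine ⟨fun hΛ x hx => ?_, fun hτΛ => ?_⟩
  · rw [hτ, hσ x hx, hh.eq_zero_of_connected hd hσ S.finite_toSet hΛ hx, sub_zero]
  have hs : Summable (cut J α h) := summable_cut hJ.le hα (b := 0) (volFinset S)
    fun x hx => hh.off_vol x fun h' => hx (mem_volFinset.2 h')
  set T := ∑' p, cut J α h p with hT
  have hSσ : ∀ x ∈ S, x ∈ boundary σ := fun x hx => by
    rw [← hA]
    exact_mod_cast P.le hSP hx
  have main : m / 4 * T ≤ energy J α ψ Λ (fun _ => 0) σ -
      energy J α ψ Λ (fun _ => 0) (γ.erase σ) := by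
    refine tsum_cut_le_energy_sub hd0 hJ hδ0.le hαδ hm hψ0 hψ hψm hσ hτΛ hτ hSP
      (P.nonempty_of_mem_parts hSP) hSσ hh hoff hext hL hsep (by linarith) hπδ ?_ ?_
    · intro C hC hCS hlt x hx s hs
      have h1 := hsepR C hC S hSP hCS x hx s hs
      rwa [min_eq_right hlt.le] at h1
    · rwa [div_mul_eq_mul_div]
  have hlab : ∀ {x : Fin d → ℤ} {n : ZMod q},
      x ∈ γ.interiorLabel n ↔ x ∈ γ.interior ∧ h x = n :=
    γ.mem_interiorLabel_iff hd hspin (hsepB S hSP) hh hσS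
  -- Off `S`, a site outside the interior lies outside the volume, where `h` is zero.
  have hout : ∀ y, y ∉ γ.interior → y ∉ S → h y = 0 := fun y hy hyS =>
    hh.off_vol y fun h' => hy ⟨h', by exact_mod_cast hyS⟩
  have hcast : ∀ n ∈ Finset.Icc 1 (q - 1), ((n : ℕ) : ZMod q).val = n := fun n hn => by
    rw [Finset.mem_Icc] at hn
    exact ZMod.val_cast_of_lt (by omega)
  have f1 := card_mul_le_tsum_cut hJ.le hh hSσ hs
  have f2 := surfaceEnergy_le_card_mul hJ.le hα S
  have f3 := sum_surfaceEnergy_le hJ.le hα S hs (Finset.Icc 1 (q - 1))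
    (fun n => γ.interiorLabel (n : ZMod q))
    (fun x n hn n' hn' hx hx' => by
      rw [← hcast n hn, ← hcast n' hn', γ.interiorLabel_unique hx hx'])
    (fun n hn x hx y hy hyS hxy => by
      rw [hlab] at hx hy
      by_cases hyI : y ∈ γ.interior
      · exact hy ⟨hyI, hxy ▸ hx.2⟩
      · have h1 : (n : ZMod q) = 0 := by rw [← hx.2, hxy, hout y hyI hyS]
        have h2 := hcast n hn
        rw [h1, ZMod.val_zero] at h2
        rw [Finset.mem_Icc] at hn
        omega)
  have f4 := sum_surfaceEnergy_le hJ.le hα S hs {()} (fun _ => γ.interior')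
    (fun _ _ _ _ _ _ _ => rfl)
    (fun _ _ x hx y hy hyS hxy => by
      obtain ⟨n, hn, hxn⟩ := hx
      rw [hlab] at hxn
      refine hn ?_
      rw [← hxn.2, hxy]
      by_contra h0
      by_cases hyI : y ∈ γ.interior
      · exact hy ⟨h y, h0, hlab.2 ⟨hyI, rfl⟩⟩
      · exact h0 (hout y hyI hyS))
  rw [Finset.sum_singleton] at f4
  rw [← hΘ] at f2 f3 f4
  have hbound : (S.card : ℝ) + surfaceEnergy J α (S : Set (Fin d → ℤ)) +
      ∑ n ∈ Finset.Icc 1 (q - 1), surfaceEnergy J α (γ.interiorLabel (n : ZMod q)) +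
      surfaceEnergy J α γ.interior' ≤ κ * T := by
    have h1 : (S.card : ℝ) * (1 + 3 * Θ) ≤ (1 + 3 * Θ) / J * T := by
      rw [div_mul_eq_mul_div, le_div_iff₀ hJ]
      have := mul_le_mul_of_nonneg_left f1 (by positivity : 0 ≤ 1 + 3 * Θ)
      linarith
    rw [hκ, add_mul]
    linarith
  refine le_trans (mul_le_mul_of_nonneg_left hbound (by positivity)) (le_trans (le_of_eq ?_) main)
  field_simp
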